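/- Let $\mathcal{L}$ be a finite-dimensional complex simple Lie algebra of simply laced type and rank at least $3$ (that is, of type $A_n$ with $n\ge 3$, $D_n$ with $n\ge 4$, or $E_6,E_7,E_8$). Let $\mathcal{H}$ be a Cartan subalgebra, $\Phi\subseteq\mathcal{H}^*$ the set of roots, $h_\alpha\in\mathcal{H}$ the coroot of $\alpha\in\Phi$, $\Lambda\subseteq\mathcal H^*$ the weight lattice (the $\lambda\in\mathcal H^*$ with $\lambda(h_\alpha)\in\mathbb{Z}$ for all $\alpha\in\Phi$), $\Delta$ a base of $\Phi$ and $\omega$ the highest root with respect to $\Delta$. Let $\kappa$ be the Killing form rescaled so that $\kappa(h_\alpha,h_\alpha)=2$ for all $\alpha\in\Phi$, and put $\kappa(\alpha,\beta)=\kappa(h_\alpha,h_\beta)$ for $\alpha,\beta\in\Phi$. Let $S^2(\mathcal{L})$ be the symmetric square of the adjoint representation, that is, the quotient of $\mathcal{L}\otimes\mathcal{L}$ by the subrepresentation generated by all $x\otimes y-y\otimes x$, and write $xy$ for the image of $x\otimes y$. Let $e_\omega$ be a nonzero element of the root space $\mathcal{L}_\omega$ and let $\mathcal{V}$ be the subrepresentation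 of $S^2(\mathcal{L})$ generated by $e_\omega e_\omega$. For $i\in\mathbb{Z}$ put $\Lambda_i=\{\alpha+\beta \mid \alpha,\beta\in\Phi,\ \kappa(\alpha,\beta)=i\}$, and for $\lambda\in\Lambda$ let $n_\lambda$ be the number of unordered pairs $\{\alpha,\beta\}$ of (possibly equal) roots with $\alpha+\beta=\lambda$. Then the formal character $\mathrm{ch}_{\mathcal V}=\sum_{\lambda\in\Lambda}\dim(\mathcal{V}_\lambda)\,e^\lambda\in\mathbb{Z}[\Lambda]$, where $\mathcal{V}_\lambda=\{v\in\mathcal{V}\mid h\cdot v=\lambda(h)v \text{ for all } h\in\mathcal{H}\}$, is $$\mathrm{ch}_{\mathcal V}=n_0+\sum_{\lambda\in\Lambda_{-1}}(n_\lambda+1)e^\lambda+\sum_{\lambda\in\Lambda_0}(n_\lambda-1)e^\lambda+\sum_{\lambda\in\Lambda_1\cup\Lambda_2}e^\lambda .$$ -/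

import Mathlib

open scoped TensorProduct
open Module LieAlgebra LieAlgebra.IsKilling

noncomputable section

namespace SimplyLacedCharacter

section RootCombinatorics

variable {L : Type*} [LieRing L] [LieAlgebra ℂ L] [FiniteDimensional ℂ L] [IsSimple ℂ L]
variable (H : LieSubalgebra ℂ L) [H.IsCartanSubalgebra]

/-- The weight lattice `Λ ⊆ H*`: the linear functionals that are integral on every coroot `h_α`. -/
def weightLattice : AddSubgroup (Dual ℂ H) where
  carrier := {lam | ∀ α : H.root, ∃ m : ℤ, lam ((rootSystem H).coroot α) = m}
  zero_mem' := fun _ ↦ ⟨0, by simp⟩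
  add_mem' := by
    intro a b ha hb α
    obtain ⟨m, hm⟩ := ha α
    obtain ⟨k, hk⟩ := hb α
    exact ⟨m + k, by rw [LinearMap.add_apply, hm, hk, Int.cast_add]⟩
  neg_mem' := by
    intro a ha α
    obtain ⟨m, hm⟩ := ha α
    exact ⟨-m, by rw [LinearMap.neg_apply, hm, Int.cast_neg]⟩

/-- The number `κ(α, β) = κ(h_α, h_β)` for roots `α`, `β`, where `κ` is the Killing form rescaled by
the factor `2 t⁻¹`, with `t = tr (ad h_γ ∘ ad h_γ)`. If all roots have the same length then `t` does
not depend on the root `γ`; it is evaluated here at `γ = α`. -/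
def kappa (α β : H.root) : ℂ :=
  2 * (killingForm ℂ L ((rootSystem H).coroot α) ((rootSystem H).coroot α))⁻¹ *
    killingForm ℂ L ((rootSystem H).coroot α) ((rootSystem H).coroot β)

/-- `Λ_i = {α + β ∣ α, β ∈ Φ, κ(α, β) = i}`, as a set of integral weights. -/
def weightSet (i : ℤ) : Set (weightLattice H) :=
  {lam | ∃ α β : H.root, kappa H α β = i ∧
    (lam : Dual ℂ H) = (rootSystem H).root α + (rootSystem H).root β}

/-- `N_λ`: the unordered pairs `{α, β}` of (possibly equal) roots with `α + β = λ`. -/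
def rootPairs (lam : weightLattice H) : Set (Sym2 H.root) :=
  {z | ∃ α β : H.root, z = s(α, β) ∧
    (rootSystem H).root α + (rootSystem H).root β = (lam : Dual ℂ H)}

/-- `n_λ = |N_λ|`, the number of ways to write `λ` as a sum of two roots. -/
def numRootPairs (lam : weightLattice H) : ℕ := (rootPairs H lam).ncard

/-- Each `Λ_i` is finite, so that the sums over it are genuine finite sums. -/
theorem weightSet_finite (i : ℤ) : (weightSet H i).Finite := by
  refine Set.Finite.of_finite_image (f := fun lam : weightLattice H ↦ (lam : Dual ℂ H))
    (Set.Finite.subset (Set.finite_range fun p : H.root × H.root ↦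
      (rootSystem H).root p.1 + (rootSystem H).root p.2) ?_) Subtype.val_injective.injOn
  rintro _ ⟨lam, ⟨α, β, -, h⟩, rfl⟩
  exact ⟨(α, β), h.symm⟩

variable {H}

/-- `ω` is the highest root with respect to the base `b`: for every root `β`, the difference `ω - β`
is a sum of simple roots (with repetitions). -/
def IsHighestRoot (b : (rootSystem H).Base) (ω : H.root) : Prop :=
  ∀ β : H.root, (rootSystem H).root ω - (rootSystem H).root β ∈
    AddSubmonoid.closure ((rootSystem H).root '' b.support)

end RootCombinatorics

section Character

variable {L : Type*} [LieRing L] [LieAlgebra ℂ L] [FiniteDimensional ℂ L] [IsSimple ℂ L]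
variable (H : LieSubalgebra ℂ L) [H.IsCartanSubalgebra]
variable (M : Type*) [AddCommGroup M] [Module ℂ M] [LieRingModule L M] [LieModule ℂ L M]
variable [FiniteDimensional ℂ M]

/-- A finite-dimensional representation has only finitely many weights in `Λ`. -/
theorem weightMultiplicity_support_finite :
    (Function.support fun lam : weightLattice H ↦
      (finrank ℂ (LieModule.weightSpace M ⇑(lam : Dual ℂ H)) : ℤ)).Finite := by
  refine Set.Finite.of_finite_image (f := fun lam : weightLattice H ↦ ⇑(lam : Dual ℂ H))
    (Set.Finite.subset (LieModule.finite_genWeightSpace_ne_bot ℂ H M) ?_)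
    (DFunLike.coe_injective.comp Subtype.val_injective).injOn
  rintro _ ⟨lam, hlam, rfl⟩ hbot
  have h := LieModule.weightSpace_le_genWeightSpace M ⇑(lam : Dual ℂ H)
  rw [hbot, le_bot_iff] at h
  have h0 : finrank ℂ (LieModule.weightSpace M ⇑(lam : Dual ℂ H)) = 0 := by
    change finrank ℂ (LieModule.weightSpace M ⇑(lam : Dual ℂ H)).toSubmodule = 0
    rw [h, LieSubmodule.bot_toSubmodule, finrank_bot]
  exact hlam (Nat.cast_eq_zero.mpr h0)

/-- The formal character `∑ m_λ e^λ ∈ ℤ[Λ]` of a representation `M`, where `m_λ` is the dimension of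
`M_λ = {v ∈ M ∣ h · v = λ(h) v for all h ∈ H}`. -/
def formalCharacter : AddMonoidAlgebra ℤ (weightLattice H) :=
  .ofCoeff (Finsupp.ofSupportFinite
    (fun lam ↦ (finrank ℂ (LieModule.weightSpace M ⇑(lam : Dual ℂ H)) : ℤ))
    (weightMultiplicity_support_finite H M))

end Character

section SymmetricSquare

variable (L : Type*) [LieRing L] [LieAlgebra ℂ L]

/-- The subrepresentation of `L ⊗ L` generated by all `x ⊗ y - y ⊗ x`. -/
def symRel : LieSubmodule ℂ L (L ⊗[ℂ] L) :=
  LieSubmodule.lieSpan ℂ L {t | ∃ x y : L, t = x ⊗ₜ[ℂ] y - y ⊗ₜ[ℂ] x}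

/-- The symmetric square `S²(L)` as a representation of `L`. -/
abbrev SymSquare : Type _ := (L ⊗[ℂ] L) ⧸ symRel L

variable {L}

/-- The product `x y ∈ S²(L)`, the image of `x ⊗ y`. -/
def symMul (x y : L) : SymSquare L := LieSubmodule.Quotient.mk (x ⊗ₜ[ℂ] y)

/-- The subrepresentation of `S²(L)` generated by `e e`. -/
def squareSubrep (e : L) : LieSubmodule ℂ L (SymSquare L) :=
  LieSubmodule.lieSpan ℂ L {symMul e e}

end SymmetricSquare

end SimplyLacedCharacter

end

/-! Write `t_α` for the element of `H` dual to `α` under the Killing form, and `(α, β)` for the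
Cartan integer, symmetric in the simply laced case. Each multiplicity is squeezed between explicit
elements of `V` and an equivariant condition that `V` satisfies.

Lower bound: lowering `e_ω e_ω` by root vectors and using irreducibility puts every square `e_α e_α`
in `V` (`sq_mem`); one or two further lowerings give elements of every relevant weight.

Upper bound: `e_ω` is extremal, i.e. `[e, [e, z]]` is a multiple of `κ(e, z) e` (`lie_e_lie_e`).
Hence, for a suitable `c ≠ 0`, the equivariant map `contraction` kills `e_ω e_ω`, and so all of `V`.

Vectors of weight `λ` are compared with functions on the `n_λ` pairs `{α, β}` of sum `λ` through
`coordMap`. If `λ` is a root, the image of `V_λ` is everything and the kernel is the line of `t_λ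
e_λ`: the `+1`. If `λ = 0`, the map is bijective, as `contraction` is injective on elements of
`S²(H)`. If `λ` is a sum of orthogonal roots, the map is injective and its image is a hyperplane:
the `-1`. If `(α, β)` is `1` or `2`, there is only one pair and `e_α e_β` lies in `V`. The value
`(α, β)` depends only on `α + β`, so these cases do not overlap. -/

set_option linter.unusedSectionVars false

noncomputable section

namespace SimplyLacedCharacter

/-! ### Cartan integers of a simply laced root system -/

section SimplyLacedRoots

variable {L : Type*} [LieRing L] [LieAlgebra ℂ L] [FiniteDimensional ℂ L] [IsSimple ℂ L]
variable {H : LieSubalgebra ℂ L} [H.IsCartanSubalgebra]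

/-- All roots have the same length for every invariant form. -/
theorem form_root_self_eq (b : (rootSystem H).Base) (hb : b.cartanMatrix.IsSimplyLaced)
    (B : (rootSystem H).InvariantForm) (α β : H.root) :
    B.form ((rootSystem H).root α) ((rootSystem H).root α) =
      B.form ((rootSystem H).root β) ((rootSystem H).root β) := by
  let len (i : H.root) : ℂ := B.form ((rootSystem H).root i) ((rootSystem H).root i)
  have hrefl (k i : H.root) : len ((rootSystem H).reflectionPerm k i) = len i := by
    simp only [len, (rootSystem H).root_reflectionPerm, B.apply_reflection_reflection]
  -- Adjacent simple roots have both Cartan integers `-1`, hence equal length; irreducibility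
  -- connects all simple roots, and reflections reach the other roots.
  have key (i j : b.support) : len i = len j := by
    refine b.induction_on_cartanMatrix
      (fun j ↦ len i = len j) (i := i) rfl ?_
    intro k l hk hlk
    rw [hk]
    rcases eq_or_ne l k with rfl | hne
    · rfl
    have h1 : b.cartanMatrix l k = 0 ∨ b.cartanMatrix l k = -1 := hb hne
    have h2 : b.cartanMatrix k l = 0 ∨ b.cartanMatrix k l = -1 := hb hne.symm
    replace h1 := h1.resolve_left hlk
    replace h2 := h2.resolve_left fun h ↦ hlk (b.cartanMatrix_apply_eq_zero_iff_symm.mp h)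
    have e1 : (rootSystem H).pairing l k = -1 := by
      rw [← b.algebraMap_cartanMatrixIn_apply ℤ, show b.cartanMatrixIn ℤ l k = -1 from h1]; simp
    have e2 : (rootSystem H).pairing k l = -1 := by
      rw [← b.algebraMap_cartanMatrixIn_apply ℤ, show b.cartanMatrixIn ℤ k l = -1 from h2]; simp
    have := B.pairing_mul_eq_pairing_mul_swap k l
    rw [e1, e2] at this
    simpa [len] using this
  have : Nonempty H.root := ⟨α⟩
  obtain ⟨j, hj⟩ := b.support_nonempty
  have all (i : H.root) : len i = len j := by
    refine b.induction_reflect i (p := fun i ↦ len i = len j) ?_ ?_ ?_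
    · intro i hi; exact (hrefl i i).trans hi
    · intro i hi; exact key ⟨i, hi⟩ ⟨j, hj⟩
    · intro i k hi _; exact (hrefl k i).trans hi
  exact (all α).trans (all β).symm

/-- The integral pairing `⟨α, β^∨⟩` of two roots. -/
abbrev cartanInt (α β : H.root) : ℤ := (rootSystem H).pairingIn ℤ α β

variable (H) in
/-- The root system is simply laced: the pairing of roots and coroots is symmetric. -/
def IsLaced : Prop := ∀ α β : H.root, cartanInt α β = cartanInt β α

theorem IsLaced.of_cartanMatrix (b : (rootSystem H).Base) (hb : b.cartanMatrix.IsSimplyLaced) :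
    IsLaced H := by
  intro α β
  have := ((rootSystem H).posRootForm ℤ).toInvariantForm.pairing_mul_eq_pairing_mul_swap α β
  rw [form_root_self_eq b hb _ α β] at this
  have h := mul_right_cancel₀ (((rootSystem H).posRootForm ℤ).form_apply_root_ne_zero β) this
  rw [← (rootSystem H).algebraMap_pairingIn ℤ,
    ← (rootSystem H).algebraMap_pairingIn ℤ α] at h
  exact ((algebraMap ℤ ℂ).injective_int h).symm

theorem IsLaced.mem_range (hl : IsLaced H) (α β : H.root) :
    cartanInt α β = -2 ∨ cartanInt α β = -1 ∨ cartanInt α β = 0 ∨ cartanInt α β = 1 ∨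
      cartanInt α β = 2 := by
  have := (rootSystem H).pairingIn_pairingIn_mem_set_of_isCrystal_of_isRed α β
  have h := hl α β
  simp only [Set.mem_insert_iff, Set.mem_singleton_iff, Prod.mk.injEq] at this
  unfold cartanInt at *
  omega

theorem IsLaced.eq_two_iff (hl : IsLaced H) {α β : H.root} : cartanInt α β = 2 ↔ α = β := by
  rw [← (rootSystem H).pairingIn_two_two_iff ℤ]
  have := hl α β
  unfold cartanInt at *
  omega

theorem IsLaced.eq_neg_two_iff (hl : IsLaced H) {α β : H.root} :
    cartanInt α β = -2 ↔ (rootSystem H).root α = -(rootSystem H).root β := by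
  rw [← (rootSystem H).pairingIn_neg_two_neg_two_iff ℤ]
  have := hl α β
  unfold cartanInt at *
  omega

@[simp] theorem cartanInt_self (α : H.root) : cartanInt α α = 2 :=
  (rootSystem H).pairingIn_same ℤ α

theorem pairing_eq_cast (α β : H.root) : (rootSystem H).pairing α β = (cartanInt α β : ℂ) :=
  ((rootSystem H).algebraMap_pairingIn ℤ α β).symm

theorem cast_cartanInt (α β : H.root) :
    (cartanInt α β : ℂ) = (rootSystem H).root α ((rootSystem H).coroot β) := by
  have := (rootSystem H).algebraMap_pairingIn ℤ α β
  simpa using this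

theorem cartanInt_add {α β γ δ : H.root} (ε : H.root)
    (h : (rootSystem H).root α + (rootSystem H).root β =
      (rootSystem H).root γ + (rootSystem H).root δ) :
    cartanInt α ε + cartanInt β ε = cartanInt γ ε + cartanInt δ ε := by
  have := DFunLike.congr_fun h ((rootSystem H).coroot ε)
  simp only [LinearMap.add_apply, ← cast_cartanInt] at this
  exact_mod_cast this

theorem cartanInt_of_eq_add {α β γ : H.root} (ε : H.root)
    (h : (rootSystem H).root γ = (rootSystem H).root α + (rootSystem H).root β) :
    cartanInt γ ε = cartanInt α ε + cartanInt β ε := by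
  have := DFunLike.congr_fun h ((rootSystem H).coroot ε)
  simp only [LinearMap.add_apply, ← cast_cartanInt] at this
  exact_mod_cast this

theorem cartanInt_of_eq_neg {α β : H.root} (ε : H.root)
    (h : (rootSystem H).root α = -(rootSystem H).root β) :
    cartanInt α ε = -cartanInt β ε := by
  have := DFunLike.congr_fun h ((rootSystem H).coroot ε)
  simp only [LinearMap.neg_apply, ← cast_cartanInt] at this
  exact_mod_cast this

/-- The value `⟨α, β^∨⟩` is determined by the sum `α + β`. -/
theorem IsLaced.cartanInt_eq_of_add_eq (hl : IsLaced H) {α β γ δ : H.root}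
    (h : (rootSystem H).root α + (rootSystem H).root β =
      (rootSystem H).root γ + (rootSystem H).root δ) :
    cartanInt α β = cartanInt γ δ := by
  -- In effect `|α + β|² = 4 + 2 (α, β)`: the equation is paired with each of the four roots and the
  -- results are added.
  have h1 := cartanInt_add α h
  have h2 := cartanInt_add β h
  have h3 := cartanInt_add γ h
  have h4 := cartanInt_add δ h
  have := cartanInt_self α
  have := cartanInt_self β
  have := cartanInt_self γ
  have := cartanInt_self δ
  have := hl α β
  have := hl γ δ
  have := hl α γ
  have := hl α δ
  have := hl β γ
  have := hl β δ
  omega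

theorem exists_root_eq_sub {α β : H.root} (h : cartanInt α β = 1) :
    ∃ γ : H.root, (rootSystem H).root α = (rootSystem H).root β + (rootSystem H).root γ := by
  obtain ⟨γ, hγ⟩ := (rootSystem H).root_sub_root_mem_of_pairingIn_pos (i := α) (j := β)
    (by unfold cartanInt at h; omega) (by rintro rfl; simp at h)
  exact ⟨γ, by rw [hγ]; abel⟩

theorem IsLaced.exists_root_eq_add (hl : IsLaced H) {α β : H.root} (h : cartanInt α β = -1) :
    ∃ γ : H.root, (rootSystem H).root γ = (rootSystem H).root α + (rootSystem H).root β :=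
  (rootSystem H).root_add_root_mem_of_pairingIn_neg (i := α) (j := β)
    (by unfold cartanInt at h; omega) (fun h' ↦ by rw [hl.eq_neg_two_iff.mpr h'] at h; omega)

/-- In rank at least two every root has a neighbour. -/
theorem exists_cartanInt_eq_one (hl : IsLaced H) (hrank : 2 ≤ finrank ℂ H) (α : H.root) :
    ∃ β : H.root, cartanInt β α = 1 := by
  by_contra! hcon
  -- Without a neighbour of pairing `1` there is none of pairing `-1` either, since `α + β` would
  -- pair to `1`. Every root is then `±α` or orthogonal to `α`, and irreducibility forces rank at
  -- most one.
  have hne (β : H.root) : cartanInt β α ≠ -1 := fun h ↦ by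
    obtain ⟨γ, hγ⟩ := hl.exists_root_eq_add h
    have := cartanInt_of_eq_add α hγ
    rw [h, cartanInt_self] at this
    exact hcon γ this
  have hmem : (rootSystem H).root α ∈ Submodule.span ℂ ((rootSystem H).root '' {α}) := by
    rw [Set.image_singleton]
    exact Submodule.mem_span_singleton_self _
  have htop := (rootSystem H).span_root_image_eq_top_of_forall_orthogonal {α}
    (Set.singleton_nonempty α) (by
      rintro β hβ i rfl
      rcases hl.mem_range β i with h | h | h | h | h
      · exact absurd (by 
          rw [hl.eq_neg_two_iff.mp h]
          exact Submodule.neg_mem _ hmem) hβ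
      · exact absurd h (hne β)
      · refine ⟨?_, ?_⟩
        · rw [pairing_eq_cast, h, Int.cast_zero]
        · rw [pairing_eq_cast, ← hl β i, h, Int.cast_zero]
      · exact absurd h (hcon β)
      · obtain rfl := hl.eq_two_iff.mp h
        exact absurd hmem hβ)
  have h1 : finrank ℂ (Dual ℂ H) ≤ 1 := by
    rw [← finrank_top, ← htop, Set.image_singleton]
    exact (finrank_span_singleton ((rootSystem H).ne_zero α)).le
  rw [Subspace.dual_finrank_eq] at h1
  omega

end SimplyLacedRoots

/-! ### The symmetric square and its pairing with `L × L` -/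

section SymSquare

variable {L : Type*} [LieRing L] [LieAlgebra ℂ L]
variable {X : Type*} [AddCommGroup X] [Module ℂ X]

theorem symMul_comm (x y : L) : symMul x y = symMul y x := by
  rw [← sub_eq_zero]
  refine (LieSubmodule.Quotient.mk_eq_zero' (N := symRel L)
    (m := x ⊗ₜ[ℂ] y - y ⊗ₜ[ℂ] x)).mpr ?_
  exact LieSubmodule.subset_lieSpan ⟨x, y, rfl⟩

theorem symMul_add (x y z : L) : symMul x (y + z) = symMul x y + symMul x z := by
  simp only [symMul, TensorProduct.tmul_add]; rfl

theorem symMul_smul (c : ℂ) (x y : L) : symMul x (c • y) = c • symMul x y := by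
  simp only [symMul, TensorProduct.tmul_smul]; rfl

theorem symMul_zero (x : L) : symMul x 0 = 0 := by
  simp only [symMul, TensorProduct.tmul_zero]; rfl

theorem add_symMul (x y z : L) : symMul (x + y) z = symMul x z + symMul y z := by
  rw [symMul_comm, symMul_add, symMul_comm z, symMul_comm z]

theorem smul_symMul (c : ℂ) (x y : L) : symMul (c • x) y = c • symMul x y := by
  rw [symMul_comm, symMul_smul, symMul_comm]

theorem lie_symMul (z x y : L) : ⁅z, symMul x y⁆ = symMul ⁅z, x⁆ y + symMul x ⁅z, y⁆ := by
  change LieSubmodule.Quotient.mk ⁅z, x ⊗ₜ[ℂ] y⁆ = _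
  rw [TensorProduct.LieModule.lie_tmul_right]
  rfl

@[elab_as_elim]
theorem symSquare_induction {p : SymSquare L → Prop} (t : SymSquare L) (zero : p 0)
    (mul : ∀ x y, p (symMul x y)) (add : ∀ s t, p s → p t → p (s + t)) : p t := by
  obtain ⟨s, rfl⟩ := LieSubmodule.Quotient.surjective_mk' (symRel L) t
  induction s using TensorProduct.induction_on with
  | zero => simpa using zero
  | tmul x y => exact mul x y
  | add s t hs ht => rw [map_add]; exact add _ _ hs ht

-- By the Leibniz rule the linear span of the generators is already stable under `L`. This is what
-- allows linear maps on `S²(L)` to be defined from arbitrary symmetric bilinear maps.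
variable (L) in
theorem symRel_toSubmodule_le : (symRel L).toSubmodule ≤
    Submodule.span ℂ {t | ∃ x y : L, t = x ⊗ₜ[ℂ] y - y ⊗ₜ[ℂ] x} := by
  let N : LieSubmodule ℂ L (L ⊗[ℂ] L) :=
    { Submodule.span ℂ {t | ∃ x y : L, t = x ⊗ₜ[ℂ] y - y ⊗ₜ[ℂ] x} with
      lie_mem := by
        intro z m hm
        change m ∈ Submodule.span ℂ _ at hm
        change ⁅z, m⁆ ∈ Submodule.span ℂ _
        induction hm using Submodule.span_induction with
        | mem t ht =>
          obtain ⟨x, y, rfl⟩ := ht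
          rw [lie_sub, TensorProduct.LieModule.lie_tmul_right,
            TensorProduct.LieModule.lie_tmul_right]
          have h1 : ⁅z, x⁆ ⊗ₜ[ℂ] y - y ⊗ₜ[ℂ] ⁅z, x⁆ ∈
              Submodule.span ℂ {t | ∃ x y : L, t = x ⊗ₜ[ℂ] y - y ⊗ₜ[ℂ] x} :=
            Submodule.subset_span ⟨_, _, rfl⟩
          have h2 : x ⊗ₜ[ℂ] ⁅z, y⁆ - ⁅z, y⁆ ⊗ₜ[ℂ] x ∈
              Submodule.span ℂ {t | ∃ x y : L, t = x ⊗ₜ[ℂ] y - y ⊗ₜ[ℂ] x} :=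
            Submodule.subset_span ⟨_, _, rfl⟩
          convert! add_mem h1 h2 using 1
          abel
        | zero => rw [lie_zero]; exact zero_mem _
        | add s t _ _ hs ht => rw [lie_add]; exact add_mem hs ht
        | smul c t _ ht => rw [lie_smul]; exact Submodule.smul_mem _ c ht }
  change symRel L ≤ N
  exact LieSubmodule.lieSpan_le.mpr Submodule.subset_span

/-- The linear map on `S²(L)` given by a symmetric bilinear map. -/
def symLift (F : L →ₗ[ℂ] L →ₗ[ℂ] X) (hF : ∀ x y, F x y = F y x) : SymSquare L →ₗ[ℂ] X :=
  (symRel L).toSubmodule.liftQ (TensorProduct.lift F) <| (symRel_toSubmodule_le L).trans <| by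
    rw [Submodule.span_le]
    rintro _ ⟨x, y, rfl⟩
    simp [hF x y]

@[simp] theorem symLift_symMul (F : L →ₗ[ℂ] L →ₗ[ℂ] X) (hF : ∀ x y, F x y = F y x) (x y : L) :
    symLift F hF (symMul x y) = F x y := by
  change (symRel L).toSubmodule.liftQ (TensorProduct.lift F) _ (Submodule.Quotient.mk _) = _
  rw [Submodule.liftQ_apply, TensorProduct.lift.tmul]

variable (L) in
/-- The symmetric bilinear form on `L` attached to an element of `S²(L)` through the Killing form:
the product `x y` gives `(u, v) ↦ κ(x, u) κ(y, v) + κ(x, v) κ(y, u)`. -/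
def dualForm : SymSquare L →ₗ[ℂ] (L →ₗ[ℂ] L →ₗ[ℂ] ℂ) :=
  symLift (LinearMap.mk₂ ℂ (fun x y ↦
      (killingForm ℂ L x).smulRight (killingForm ℂ L y) +
        (killingForm ℂ L y).smulRight (killingForm ℂ L x))
      (by intros; ext; simp; ring) (by intros; ext; simp; ring)
      (by intros; ext; simp; ring) (by intros; ext; simp; ring))
    (by intros; ext; simp; ring)

theorem dualForm_symMul (x y u v : L) : dualForm L (symMul x y) u v =
    killingForm ℂ L x u * killingForm ℂ L y v + killingForm ℂ L x v * killingForm ℂ L y u := by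
  simp [dualForm]; ring

theorem dualForm_comm (t : SymSquare L) (u v : L) : dualForm L t u v = dualForm L t v u := by
  induction t using symSquare_induction with
  | zero => simp
  | mul x y => rw [dualForm_symMul, dualForm_symMul]; ring
  | add s t hs ht => simp [hs, ht]

theorem killingForm_lie_left (z x u : L) :
    killingForm ℂ L ⁅z, x⁆ u = -killingForm ℂ L x ⁅z, u⁆ := by
  rw [← lie_skew, map_neg, LinearMap.neg_apply, LieModule.traceForm_apply_lie_apply]

theorem dualForm_lie (z : L) (t : SymSquare L) (u v : L) :
    dualForm L ⁅z, t⁆ u v = -dualForm L t ⁅z, u⁆ v - dualForm L t u ⁅z, v⁆ := by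
  induction t using symSquare_induction with
  | zero => simp
  | mul x y =>
    rw [lie_symMul, map_add, LinearMap.add_apply, LinearMap.add_apply]
    simp only [dualForm_symMul, killingForm_lie_left]
    ring
  | add s t hs ht =>
    simp only [lie_add, map_add, LinearMap.add_apply, hs, ht]; ring

/-- As `κ` is nondegenerate, the values of the form include all coordinates of the symmetrization `x
⊗ y + y ⊗ x`, and projecting the latter back to `S²(L)` multiplies by `2`. -/
theorem eq_zero_of_dualForm_eq_zero [FiniteDimensional ℂ L] [IsKilling ℂ L] {t : SymSquare L}
    (ht : ∀ u v, dualForm L t u v = 0) : t = 0 := by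
  let b := Module.finBasis ℂ L
  have hsep : (killingForm ℂ L).Nondegenerate := IsKilling.killingForm_nondegenerate ℂ L
  have hsurj (g : Dual ℂ L) : ∃ u, ∀ x, g x = killingForm ℂ L x u := by
    obtain ⟨u, hu⟩ := (LinearMap.BilinForm.toDual (killingForm ℂ L) hsep).surjective g
    refine ⟨u, fun x ↦ ?_⟩
    rw [← hu, LinearMap.BilinForm.toDual_def, LieModule.traceForm_comm]
  let σ : SymSquare L →ₗ[ℂ] L ⊗[ℂ] L :=
    symLift (TensorProduct.mk ℂ L L + (TensorProduct.mk ℂ L L).flip)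
      (fun x y ↦ by simp [add_comm])
  have hσmul (x y : L) : σ (symMul x y) = x ⊗ₜ y + y ⊗ₜ x := symLift_symMul _ _ x y
  have hσ : σ t = 0 := by
    refine (b.tensorProduct b).ext_elem fun ⟨i, j⟩ ↦ ?_
    obtain ⟨u, hu⟩ := hsurj (b.coord i)
    obtain ⟨v, hv⟩ := hsurj (b.coord j)
    have key (t : SymSquare L) : (b.tensorProduct b).repr (σ t) (i, j) = dualForm L t u v := by
      induction t using symSquare_induction with
      | zero => simp
      | mul x y =>
        have hu' := fun x ↦ (hu x).symm
        have hv' := fun x ↦ (hv x).symm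
        simp only [Basis.coord_apply] at hu' hv'
        rw [dualForm_symMul, hu', hv', hu', hv', hσmul]
        simp [mul_comm]
      | add s t hs ht => simp [hs, ht]
    rw [key, ht]; simp
  let μ : L ⊗[ℂ] L →ₗ[ℂ] SymSquare L :=
    (symRel L).toSubmodule.mkQ
  have hμ (t : SymSquare L) : μ (σ t) = (2 : ℂ) • t := by
    induction t using symSquare_induction with
    | zero => simp
    | mul x y =>
      have h2 (x y : L) : μ (x ⊗ₜ y) = symMul x y := rfl
      rw [hσmul, map_add, h2, h2, symMul_comm y x, two_smul]
    | add s t hs ht => simp [hs, ht]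
  have := hμ t
  rw [hσ, map_zero] at this
  simpa using this.symm

end SymSquare

/-! ### The equivariant map that cuts out `V` from above -/

section Contraction

variable {L : Type*} [LieRing L] [LieAlgebra ℂ L]

variable (L) in
/-- The map `S²(L) → End(L)` that sends `x y` to
`z ↦ [x, [y, z]] + [y, [x, z]] - c (κ(x, z) y + κ(y, z) x)`. -/
def contraction (c : ℂ) : SymSquare L →ₗ[ℂ] (L →ₗ[ℂ] L) :=
  symLift (LinearMap.mk₂ ℂ (fun x y ↦
      ad ℂ L x ∘ₗ ad ℂ L y + ad ℂ L y ∘ₗ ad ℂ L x -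
        c • ((killingForm ℂ L x).smulRight y + (killingForm ℂ L y).smulRight x))
      (by intros; ext; simp; module) (by intros; ext; simp; module)
      (by intros; ext; simp; module) (by intros; ext; simp; module))
    (by intros; ext; simp; module)

theorem contraction_symMul (c : ℂ) (x y z : L) : contraction L c (symMul x y) z =
    ⁅x, ⁅y, z⁆⁆ + ⁅y, ⁅x, z⁆⁆ - c • (killingForm ℂ L x z • y + killingForm ℂ L y z • x) := by
  simp [contraction]

/-- Equivariance follows from the Jacobi identity and the invariance of `κ`, for every `c`.
Membership of a subrepresentation in the kernel can therefore be tested on a generator. -/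
theorem contraction_lie (c : ℂ) (w : L) (t : SymSquare L) (z : L) :
    contraction L c ⁅w, t⁆ z = ⁅w, contraction L c t z⁆ - contraction L c t ⁅w, z⁆ := by
  induction t using symSquare_induction with
  | zero => simp
  | mul x y =>
    rw [lie_symMul, map_add, LinearMap.add_apply]
    simp only [contraction_symMul, killingForm_lie_left, lie_lie, lie_add, lie_sub, lie_smul,
      smul_add, neg_smul]
    module
  | add s t hs ht =>
    simp only [lie_add, map_add, LinearMap.add_apply, hs, ht]; abel

variable (L) in
/-- The kernel of the contraction map is a subrepresentation. -/
def contractionKer (c : ℂ) : LieSubmodule ℂ L (SymSquare L) :=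
  { LinearMap.ker (contraction L c) with
    lie_mem := by
      intro w t ht
      change contraction L c t = 0 at ht
      change contraction L c ⁅w, t⁆ = 0
      ext z
      rw [contraction_lie, ht]; simp }

end Contraction

/-! ### Root vectors, their brackets and extremality -/

section RootVectors

variable {L : Type*} [LieRing L] [LieAlgebra ℂ L] [FiniteDimensional ℂ L] [IsSimple ℂ L]
variable {H : LieSubalgebra ℂ L} [H.IsCartanSubalgebra]

theorem lie_mem_rootSpace {χ ψ : Dual ℂ H} {x y : L} (hx : x ∈ rootSpace H ⇑χ)
    (hy : y ∈ rootSpace H ⇑ψ) : ⁅x, y⁆ ∈ rootSpace H ⇑(χ + ψ) :=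
  lie_mem_genWeightSpace_of_mem_genWeightSpace hx hy

theorem lie_eq_smul {χ : Dual ℂ H} {x : L} (hx : x ∈ rootSpace H ⇑χ) (h : H) :
    ⁅(h : L), x⁆ = χ h • x :=
  lie_eq_smul_of_mem_rootSpace hx h

theorem coe_mem_rootSpace_zero (h : H) : (h : L) ∈ rootSpace H ⇑(0 : Dual ℂ H) := by
  have := h.2
  rw [← LieSubalgebra.mem_toLieSubmodule, ← rootSpace_zero_eq ℂ L H] at this
  exact this

theorem killingForm_eq_zero {χ ψ : Dual ℂ H} {x y : L} (hx : x ∈ rootSpace H ⇑χ)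
    (hy : y ∈ rootSpace H ⇑ψ) (h : χ + ψ ≠ 0) : killingForm ℂ L x y = 0 :=
  killingForm_apply_eq_zero_of_mem_rootSpace_of_add_ne_zero ℂ L H hx hy
    fun h' ↦ h (DFunLike.coe_injective h')

theorem exists_root_eq {χ : Dual ℂ H} {x : L} (hx : x ∈ rootSpace H ⇑χ) (hx0 : x ≠ 0)
    (hχ : χ ≠ 0) : ∃ α : H.root, (rootSystem H).root α = χ := by
  have hne : rootSpace H ⇑χ ≠ ⊥ := fun h ↦ hx0 (by rw [h] at hx; simpa using hx)
  let w : LieModule.Weight ℂ H L := ⟨⇑χ, hne⟩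
  have hw : w ∈ H.root := by
    simp only [LieSubalgebra.root, Finset.mem_filter, Finset.mem_univ, true_and]
    exact fun h ↦ hχ (DFunLike.coe_injective h)
  exact ⟨⟨w, hw⟩, by ext; rfl⟩

theorem eq_zero_of_mem_rootSpace {χ : Dual ℂ H} {x : L} (hx : x ∈ rootSpace H ⇑χ)
    (h0 : χ ≠ 0) (hχ : ∀ α : H.root, (rootSystem H).root α ≠ χ) : x = 0 := by
  by_contra h
  obtain ⟨α, hα⟩ := exists_root_eq hx h h0
  exact hχ α hα

/-- Root vectors `e α`, `f α` for `α` and `-α`, with `κ(e α, f α) = 1`. -/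
structure RootVectors (e f : H.root → L) : Prop where
  e_mem : ∀ α, e α ∈ rootSpace H ⇑((rootSystem H).root α)
  f_mem : ∀ α, f α ∈ rootSpace H ⇑(-(rootSystem H).root α)
  killing : ∀ α, killingForm ℂ L (e α) (f α) = 1

theorem exists_dual_rootVector (α : H.root) {x : L} (hx : x ∈ rootSpace H ⇑((rootSystem H).root α))
    (hx0 : x ≠ 0) : ∃ y ∈ rootSpace H ⇑(-(rootSystem H).root α), killingForm ℂ L x y = 1 := by
  obtain ⟨y, hy, hxy⟩ : ∃ y ∈ rootSpace H ⇑(-(rootSystem H).root α), killingForm ℂ L x y ≠ 0 := by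
    by_contra! h
    apply hx0
    have := mem_ker_killingForm_of_mem_rootSpace_of_forall_rootSpace_neg ℂ L H hx h
    simpa using this
  exact ⟨(killingForm ℂ L x y)⁻¹ • y, SMulMemClass.smul_mem _ hy, by simp [hxy]⟩

theorem exists_rootVectors (ω : H.root) {x : L} (hx : x ∈ rootSpace H ⇑((rootSystem H).root ω))
    (hx0 : x ≠ 0) : ∃ e f : H.root → L, RootVectors e f ∧ e ω = x := by
  have h1 (α : H.root) : ∃ e ∈ rootSpace H ⇑((rootSystem H).root α), e ≠ 0 ∧ (α = ω → e = x) := by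
    by_cases h : α = ω
    · subst h; exact ⟨x, hx, hx0, fun _ ↦ rfl⟩
    · obtain ⟨y, hy, hy0⟩ := α.1.exists_ne_zero
      exact ⟨y, hy, hy0, fun h' ↦ absurd h' h⟩
  choose e he he0 hex using h1
  choose f hf hef using fun α ↦ exists_dual_rootVector α (he α) (he0 α)
  exact ⟨e, f, ⟨he, hf, hef⟩, hex ω rfl⟩

variable (H) in
/-- The element of `H` dual to a root with respect to the Killing form. -/
def dualElt (α : H.root) : H := (cartanEquivDual H).symm ((rootSystem H).root α)

theorem killingForm_dualElt (α : H.root) (h : H) :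
    killingForm ℂ L (dualElt H α) h = (rootSystem H).root α h :=
  DFunLike.congr_fun ((cartanEquivDual H).apply_symm_apply ((rootSystem H).root α)) h

theorem root_dualElt_self_ne_zero (α : H.root) : (rootSystem H).root α (dualElt H α) ≠ 0 :=
  root_apply_cartanEquivDual_symm_ne_zero (H.isNonZero_coe_root α)

theorem coroot_eq_smul_dualElt (α : H.root) : (rootSystem H).coroot α =
    (2 * ((rootSystem H).root α (dualElt H α))⁻¹) • dualElt H α := by
  rw [mul_smul, ofNat_smul_eq_nsmul]
  rfl

theorem two_mul_root_dualElt (α β : H.root) : 2 * (rootSystem H).root β (dualElt H α) =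
    (rootSystem H).root α (dualElt H α) * cartanInt β α := by
  have := root_dualElt_self_ne_zero α
  rw [cast_cartanInt, coroot_eq_smul_dualElt, map_smul, smul_eq_mul]
  field_simp

namespace RootVectors

variable {e f : H.root → L} (hv : RootVectors e f)
include hv

theorem e_ne_zero (α : H.root) : e α ≠ 0 := fun h ↦ by
  have := hv.killing α
  simp [h] at this

theorem f_ne_zero (α : H.root) : f α ≠ 0 := fun h ↦ by
  have := hv.killing α
  simp [h] at this

theorem killing_e_f (α β : H.root) [Decidable (α = β)] :
    killingForm ℂ L (e α) (f β) = if α = β then 1 else 0 := by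
  split_ifs with h
  · rw [h, hv.killing]
  · refine killingForm_eq_zero (hv.e_mem α) (hv.f_mem β) fun h' ↦ h ?_
    exact (rootSystem H).root.injective (by rwa [← sub_eq_add_neg, sub_eq_zero] at h')

theorem killing_coe_f (h : H) (β : H.root) : killingForm ℂ L (h : L) (f β) = 0 :=
  killingForm_eq_zero (coe_mem_rootSpace_zero h) (hv.f_mem β) (by simp)

theorem killing_e_coe (h : H) (β : H.root) : killingForm ℂ L (e β) (h : L) = 0 :=
  killingForm_eq_zero (hv.e_mem β) (coe_mem_rootSpace_zero h) (by simp)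

theorem lie_e_f (α : H.root) : ⁅e α, f α⁆ = (dualElt H α : L) := by
  have := lie_eq_killingForm_smul_of_mem_rootSpace_of_mem_rootSpace_neg
    (α := α.1) (hv.e_mem α) (hv.f_mem α)
  rw [hv.killing, one_smul] at this
  exact this

theorem eq_smul_e {α : H.root} {x : L} (hx : x ∈ rootSpace H ⇑((rootSystem H).root α)) :
    x = killingForm ℂ L x (f α) • e α := by
  have h1 := finrank_rootSpace_eq_one α.1 (H.isNonZero_coe_root α)
  obtain ⟨c, hc⟩ := (finrank_eq_one_iff_of_nonzero' (⟨e α, hv.e_mem α⟩ : rootSpace H α.1)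
    (fun h ↦ hv.e_ne_zero α (congrArg Subtype.val h))).mp h1 ⟨x, hx⟩
  have hc' : c • e α = x := congrArg Subtype.val hc
  rw [← hc', map_smul, LinearMap.smul_apply, hv.killing, smul_eq_mul, mul_one]

theorem eq_smul_f {α : H.root} {x : L} (hx : x ∈ rootSpace H ⇑(-(rootSystem H).root α)) :
    x = killingForm ℂ L (e α) x • f α := by
  have h1 := finrank_rootSpace_eq_one (-α.1) (H.isNonZero_coe_root α).neg
  obtain ⟨c, hc⟩ := (finrank_eq_one_iff_of_nonzero'
    (⟨f α, hv.f_mem α⟩ : rootSpace H ⇑(-α.1))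
    (fun h ↦ hv.f_ne_zero α (congrArg Subtype.val h))).mp h1 ⟨x, hx⟩
  have hc' : c • f α = x := congrArg Subtype.val hc
  rw [← hc', map_smul, hv.killing, smul_eq_mul, mul_one]

/-- Since `(α, γ) = 1`, `α + γ` is not a root, so `[e_γ, [f_γ, e_α]] = [t_γ, e_α] = α(t_γ) e_α`,
which is nonzero. -/
theorem lie_f_e (hl : IsLaced H) {α γ δ : H.root} (h : cartanInt α γ = 1)
    (hδ : (rootSystem H).root α = (rootSystem H).root γ + (rootSystem H).root δ) :
    ∃ c : ℂ, c ≠ 0 ∧ ⁅f γ, e α⁆ = c • e δ := by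
  have hmem : ⁅f γ, e α⁆ ∈ rootSpace H ⇑((rootSystem H).root δ) := by
    have := lie_mem_rootSpace (hv.f_mem γ) (hv.e_mem α)
    rwa [hδ, neg_add_cancel_left] at this
  refine ⟨_, ?_, hv.eq_smul_e hmem⟩
  intro h0
  have hz : ⁅f γ, e α⁆ = 0 := by rw [hv.eq_smul_e hmem, h0, zero_smul]
  have hsum : ⁅e γ, e α⁆ = 0 := by
    refine eq_zero_of_mem_rootSpace (lie_mem_rootSpace (hv.e_mem γ) (hv.e_mem α)) ?_ ?_
    · intro h'
      have := hl.eq_neg_two_iff.mpr (eq_neg_of_add_eq_zero_right h')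
      omega
    · intro ε hε
      have := cartanInt_of_eq_add γ hε
      have := hl.mem_range ε γ
      have := cartanInt_self γ
      omega
  have h1 := leibniz_lie (e γ) (f γ) (e α)
  rw [hz, hsum, lie_zero, lie_zero, add_zero, hv.lie_e_f, lie_eq_smul (hv.e_mem α)] at h1
  have h2 := two_mul_root_dualElt γ α
  rw [(smul_eq_zero.mp h1.symm).resolve_right (hv.e_ne_zero α), h] at h2
  exact root_dualElt_self_ne_zero γ (by simpa using h2.symm)

/-- If `α - γ` were a root, it would pair with `γ` to at most `-2`, so it would be `-γ` and `α`
would vanish. -/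
theorem lie_f_e_eq_zero (hl : IsLaced H) {α γ : H.root} (h : cartanInt α γ ≤ 0) :
    ⁅f γ, e α⁆ = 0 := by
  have := cartanInt_self γ
  refine eq_zero_of_mem_rootSpace (lie_mem_rootSpace (hv.f_mem γ) (hv.e_mem α)) ?_ ?_
  · intro h'
    have : (rootSystem H).root α = (rootSystem H).root γ := by
      rw [neg_add_eq_zero] at h'; exact h'.symm
    rw [(rootSystem H).root.injective this] at h
    omega
  · intro ε hε
    have hε' : (rootSystem H).root α = (rootSystem H).root ε + (rootSystem H).root γ := by
      rw [hε]; abel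
    have h1 := cartanInt_of_eq_add γ hε'
    have h2 := hl.mem_range ε γ
    have h3 := cartanInt_of_eq_neg α (hl.eq_neg_two_iff.mp (show cartanInt ε γ = -2 by omega))
    have h4 := cartanInt_of_eq_add α hε'
    have := cartanInt_self α
    omega

/-- `H` and the vectors `f α` span `L`, because root spaces are lines and `-α` runs over all roots.
-/
theorem linearMap_eq_zero {X : Type*} [AddCommGroup X] [Module ℂ X] (g : L →ₗ[ℂ] X)
    (hH : ∀ h : H, g h = 0) (hf : ∀ α, g (f α) = 0) : g = 0 := by
  ext x
  have hx : x ∈ ⨆ χ : LieModule.Weight ℂ H L, LieModule.genWeightSpace L χ := by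
    simp [LieModule.iSup_genWeightSpace_eq_top' ℂ H L]
  induction hx using LieSubmodule.iSup_induction' with
  | zero => simp
  | add x y _ _ hx hy => rw [map_add, hx, hy]; simp
  | mem χ x hx =>
    by_cases hχ : χ.IsZero
    · have : x ∈ H := by
        rw [show ⇑χ = 0 from hχ] at hx
        rwa [← LieSubalgebra.mem_toLieSubmodule, ← rootSpace_zero_eq ℂ L H]
      exact hH ⟨x, this⟩
    · have hmem : -χ ∈ H.root := by
        simp only [LieSubalgebra.root, Finset.mem_filter, Finset.mem_univ, true_and]
        exact LieModule.Weight.IsNonZero.neg hχ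
      have hx' : x ∈ rootSpace H ⇑(-(rootSystem H).root ⟨-χ, hmem⟩) := by
        convert! hx using 2
        ext; simp
      rw [hv.eq_smul_f hx', map_smul, hf, smul_zero]; simp

/-- Root vectors for a root are extremal elements. -/
theorem lie_e_lie_e (hl : IsLaced H) (α : H.root) (z : L) : ⁅e α, ⁅e α, z⁆⁆ =
    (-(rootSystem H).root α (dualElt H α) * killingForm ℂ L (e α) z) • e α := by
  let g : L →ₗ[ℂ] L := ad ℂ L (e α) ∘ₗ ad ℂ L (e α) +
    (rootSystem H).root α (dualElt H α) • (killingForm ℂ L (e α)).smulRight (e α)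
  have hlie (h : H) : ⁅e α, (h : L)⁆ = -((rootSystem H).root α h • e α) := by
    rw [← lie_skew, lie_eq_smul (hv.e_mem α)]
  suffices h : g = 0 by
    have := LinearMap.congr_fun h z
    simp only [g, LinearMap.add_apply, LinearMap.comp_apply, ad_apply, LinearMap.smul_apply,
      LinearMap.smulRight_apply, LinearMap.zero_apply] at this
    rw [eq_neg_of_add_eq_zero_left this, smul_smul, neg_mul, neg_smul]
  -- Both terms of `g` vanish on `H`. On `f α` they cancel by `[e_α, t_α] = -α(t_α) e_α`, and for `β
  -- ≠ α` the weight `2α - β` is neither zero nor a root.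
  refine hv.linearMap_eq_zero g (fun h ↦ ?_) fun β ↦ ?_
  · simp [g, hlie, hv.killing_e_coe]
  · classical
    simp only [g, LinearMap.add_apply, LinearMap.comp_apply, ad_apply, LinearMap.smul_apply,
      LinearMap.smulRight_apply, hv.killing_e_f]
    split_ifs with h
    · rw [← h, hv.lie_e_f, hlie]; simp
    · rw [zero_smul, smul_zero, add_zero]
      refine eq_zero_of_mem_rootSpace (lie_mem_rootSpace (hv.e_mem α)
        (lie_mem_rootSpace (hv.e_mem α) (hv.f_mem β))) ?_ ?_
      · intro h'
        have hβ : (rootSystem H).root β = (rootSystem H).root α + (rootSystem H).root α := by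
          rw [← sub_eq_zero, ← neg_eq_zero, ← h']; abel
        have := cartanInt_of_eq_add α hβ
        have := hl.mem_range β α
        have := cartanInt_self α
        omega
      · intro ε hε
        have h1 : (rootSystem H).root α + (rootSystem H).root α =
            (rootSystem H).root ε + (rootSystem H).root β := by rw [hε]; abel
        have h1 := cartanInt_add α h1
        have := hl.mem_range β α
        have := hl.mem_range ε α
        have := cartanInt_self α
        exact h (hl.eq_two_iff.mp (show cartanInt β α = 2 by omega)).symm

end RootVectors
end RootVectors

/-! ### A trace identity for the contraction -/

section TraceIdentity

variable {L : Type*} [LieRing L] [LieAlgebra ℂ L]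

/-- The map `x y ↦ [h, x] [h', y] + [h', x] [h, y]` on `S²(L)`. -/
def symAd (h h' : L) : SymSquare L →ₗ[ℂ] SymSquare L :=
  symLift (LinearMap.mk₂ ℂ (fun x y ↦ symMul ⁅h, x⁆ ⁅h', y⁆ + symMul ⁅h', x⁆ ⁅h, y⁆)
      (by intros; simp only [lie_add, add_symMul]; abel)
      (by intros; simp only [lie_smul, smul_symMul, smul_add])
      (by intros; simp only [lie_add, symMul_add]; abel)
      (by intros; simp only [lie_smul, symMul_smul, smul_add]))
    (fun x y ↦ by
      simp only [LinearMap.mk₂_apply]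
      rw [symMul_comm ⁅h, x⁆, symMul_comm ⁅h', x⁆, add_comm])

theorem symAd_symMul (h h' x y : L) : symAd h h' (symMul x y) =
    symMul ⁅h, x⁆ ⁅h', y⁆ + symMul ⁅h', x⁆ ⁅h, y⁆ := by
  simp [symAd]

variable (L) in
/-- The linear form `x y ↦ κ(x, y)` on `S²(L)`. -/
def symTrace : SymSquare L →ₗ[ℂ] ℂ :=
  symLift (killingForm ℂ L) fun x y ↦ LieModule.traceForm_comm ℂ L L x y

theorem symTrace_symMul (x y : L) : symTrace L (symMul x y) = killingForm ℂ L x y := by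
  simp [symTrace]

theorem dualForm_symAd (h h' : L) (t : SymSquare L) (u v : L) :
    dualForm L (symAd h h' t) u v = dualForm L t ⁅h, u⁆ ⁅h', v⁆ + dualForm L t ⁅h', u⁆ ⁅h, v⁆ := by
  induction t using symSquare_induction with
  | zero => simp
  | mul x y =>
    simp only [symAd_symMul, map_add, LinearMap.add_apply, dualForm_symMul, killingForm_lie_left]
    ring
  | add s t hs ht => simp only [map_add, LinearMap.add_apply, hs, ht]; ring

/-- Invariance gives `κ([x, [y, h]], h') = -κ([h', x], [h, y])`. For `t` in `S²(H)` and `h`, `h'` in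
`H` the trace term vanishes, so if `c ≠ 0` the contraction of `t` determines the form of `t` on `H`.
-/
theorem killingForm_contraction (c : ℂ) (t : SymSquare L) (h h' : L) :
    killingForm ℂ L (contraction L c t h) h' =
      -symTrace L (symAd h h' t) - c * dualForm L t h h' := by
  induction t using symSquare_induction with
  | zero => simp
  | mul x y =>
    have key (x y : L) :
        killingForm ℂ L ⁅x, ⁅y, h⁆⁆ h' = -killingForm ℂ L ⁅h', x⁆ ⁅h, y⁆ := by
      rw [killingForm_lie_left, ← lie_skew y h, ← lie_skew x h', map_neg, map_neg,
        LinearMap.neg_apply, neg_neg, LieModule.traceForm_comm]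
    simp only [symAd_symMul, map_add, dualForm_symMul, symTrace_symMul, contraction_symMul,
      map_sub, map_smul, LinearMap.add_apply, LinearMap.sub_apply, LinearMap.smul_apply,
      smul_eq_mul, key]
    rw [LieModule.traceForm_comm ℂ L L ⁅h', y⁆]
    ring
  | add s t hs ht => simp only [map_add, LinearMap.add_apply, hs, ht]; ring

end TraceIdentity

/-! ### Weight vectors in `S²(L)` -/

section Weights

variable {L : Type*} [LieRing L] [LieAlgebra ℂ L] [FiniteDimensional ℂ L] [IsSimple ℂ L]
variable {H : LieSubalgebra ℂ L} [H.IsCartanSubalgebra]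

/-- The vectors of weight `χ` in a subrepresentation of `S²(L)`. -/
def weightPart (V : LieSubmodule ℂ L (SymSquare L)) (χ : Dual ℂ H) : Submodule ℂ (SymSquare L) where
  carrier := {t | t ∈ V ∧ ∀ h : H, ⁅(h : L), t⁆ = χ h • t}
  zero_mem' := ⟨zero_mem _, fun h ↦ by simp⟩
  add_mem' := by
    rintro s t ⟨hs, hs'⟩ ⟨ht, ht'⟩
    exact ⟨add_mem hs ht, fun h ↦ by rw [lie_add, hs', ht', smul_add]⟩
  smul_mem' := by
    rintro c t ⟨ht, ht'⟩
    exact ⟨SMulMemClass.smul_mem c ht, fun h ↦ by rw [lie_smul, ht', smul_comm]⟩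

theorem mem_weightPart {V : LieSubmodule ℂ L (SymSquare L)} {χ : Dual ℂ H} {t : SymSquare L} :
    t ∈ weightPart V χ ↔ t ∈ V ∧ ∀ h : H, ⁅(h : L), t⁆ = χ h • t := Iff.rfl

theorem finrank_weightSpace_eq (V : LieSubmodule ℂ L (SymSquare L)) (χ : Dual ℂ H) :
    finrank ℂ (LieModule.weightSpace (L := H) V ⇑χ) = finrank ℂ (weightPart V χ) := by
  have h : (LieModule.weightSpace (L := H) V ⇑χ).toSubmodule.map V.toSubmodule.subtype =
      weightPart V χ := by
    ext t
    have hmem (s : V) : s ∈ (LieModule.weightSpace (L := H) V ⇑χ).toSubmodule ↔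
        ∀ h : H, ⁅h, s⁆ = χ h • s := LieModule.mem_weightSpace _ _
    simp only [Submodule.mem_map, hmem, mem_weightPart]
    constructor
    · rintro ⟨s, hs, rfl⟩
      exact ⟨s.2, fun h ↦ congrArg Subtype.val (hs h)⟩
    · rintro ⟨ht, ht'⟩
      exact ⟨⟨t, ht⟩, fun h ↦ Subtype.ext (ht' h), rfl⟩
  rw [← h]
  exact (Submodule.equivMapOfInjective V.toSubmodule.subtype Subtype.val_injective
    (LieModule.weightSpace (L := H) V ⇑χ).toSubmodule).finrank_eq

theorem symMul_weight {χ ψ : Dual ℂ H} {x y : L} (hx : x ∈ rootSpace H ⇑χ)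
    (hy : y ∈ rootSpace H ⇑ψ) (h : H) : ⁅(h : L), symMul x y⁆ = (χ + ψ) h • symMul x y := by
  rw [lie_symMul, lie_eq_smul hx, lie_eq_smul hy, smul_symMul, symMul_smul, ← add_smul,
    LinearMap.add_apply]

/-- The form is invariant under `H`, so `χ + μ + ν` annihilates its value. -/
theorem dualForm_eq_zero {χ μ ν : Dual ℂ H} {t : SymSquare L}
    (ht : ∀ h : H, ⁅(h : L), t⁆ = χ h • t) {u v : L} (hu : u ∈ rootSpace H ⇑μ)
    (hv : v ∈ rootSpace H ⇑ν) (hne : χ + μ + ν ≠ 0) : dualForm L t u v = 0 := by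
  obtain ⟨h, hh⟩ : ∃ h, (χ + μ + ν) h ≠ 0 := by
    by_contra! hcon
    exact hne (LinearMap.ext hcon)
  have := dualForm_lie (h : L) t u v
  rw [ht, lie_eq_smul hu, lie_eq_smul hv] at this
  simp only [map_smul, LinearMap.smul_apply, smul_eq_mul] at this
  have h2 : (χ + μ + ν) h * dualForm L t u v = 0 := by
    simp only [LinearMap.add_apply]
    linear_combination this
  exact (mul_eq_zero.mp h2).resolve_left hh

namespace RootVectors

variable {e f : H.root → L} (hv : RootVectors e f)
include hv

theorem dualForm_symMul_e (α β γ δ : H.root) [DecidableEq H.root] :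
    dualForm L (symMul (e α) (e β)) (f γ) (f δ) =
      (if α = γ then 1 else 0) * (if β = δ then 1 else 0) +
        (if α = δ then 1 else 0) * (if β = γ then 1 else 0) := by
  simp only [dualForm_symMul, hv.killing_e_f]

theorem dualForm_symMul_coe (h : H) (x : L) (γ δ : H.root) :
    dualForm L (symMul (h : L) x) (f γ) (f δ) = 0 := by
  simp [dualForm_symMul, hv.killing_coe_f]

theorem ext_dualForm {s t : SymSquare L}
    (h1 : ∀ α β, dualForm L s (f α) (f β) = dualForm L t (f α) (f β))
    (h2 : ∀ (h : H) (β), dualForm L s (h : L) (f β) = dualForm L t (h : L) (f β))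
    (h3 : ∀ h h' : H, dualForm L s (h : L) (h' : L) = dualForm L t (h : L) (h' : L)) : s = t := by
  rw [← sub_eq_zero]
  have key : dualForm L (s - t) = 0 := by
    refine hv.linearMap_eq_zero _ (fun h ↦ ?_) fun α ↦ ?_
    · refine hv.linearMap_eq_zero _ (fun h' ↦ ?_) fun β ↦ ?_
      · simp [h3]
      · simp [h2]
    · refine hv.linearMap_eq_zero _ (fun h ↦ ?_) fun β ↦ ?_
      · rw [dualForm_comm]; simp [h2]
      · simp [h1]
  exact eq_zero_of_dualForm_eq_zero fun u v ↦ by rw [key]; rfl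

theorem symMul_e_e_ne_zero (α β : H.root) : symMul (e α) (e β) ≠ 0 := fun h ↦ by
  classical
  have := hv.dualForm_symMul_e α β α β
  rw [h] at this
  simp only [map_zero, LinearMap.zero_apply, if_true] at this
  split_ifs at this <;> norm_num at this

end RootVectors

end Weights

theorem mem_of_smul_mem {L : Type*} [LieRing L] [LieAlgebra ℂ L]
    {V : LieSubmodule ℂ L (SymSquare L)} {c : ℂ} (hc : c ≠ 0) {t : SymSquare L}
    (h : c • t ∈ V) : t ∈ V := by
  have := V.smul_mem c⁻¹ h
  rwa [inv_smul_smul₀ hc] at this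

/-! ### Explicit elements of `V` -/

section Generation

variable {L : Type*} [LieRing L] [LieAlgebra ℂ L] [FiniteDimensional ℂ L] [IsSimple ℂ L]
variable {H : LieSubalgebra ℂ L} [H.IsCartanSubalgebra]

namespace RootVectors

variable {e f : H.root → L} (hv : RootVectors e f) (hl : IsLaced H)
variable {V : LieSubmodule ℂ L (SymSquare L)}
include hv hl

/-- With `γ = α - δ`, lowering `e_α e_α` by `f_γ` gives a nonzero multiple of `e_α e_δ`. -/
theorem mul_mem_of_sq_mem {α δ : H.root} (hα : symMul (e α) (e α) ∈ V) (h : cartanInt α δ = 1) :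
    symMul (e α) (e δ) ∈ V := by
  obtain ⟨γ, hγ⟩ := exists_root_eq_sub h
  rw [add_comm] at hγ
  have h1 : cartanInt α γ = 1 := by
    have := cartanInt_of_eq_add α hγ
    have := cartanInt_self α
    have := hl α δ
    have := hl α γ
    omega
  obtain ⟨c, hc, hce⟩ := hv.lie_f_e hl h1 hγ
  have hmem := V.lie_mem (x := f γ) hα
  rw [lie_symMul, hce, smul_symMul, symMul_smul, symMul_comm (e δ), ← smul_add, ← two_smul ℂ,
    smul_smul] at hmem
  exact mem_of_smul_mem (mul_ne_zero hc two_ne_zero) hmem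

/-- The same `f_γ` is applied again: it sends `e_α` to a multiple of `e_δ` and kills `e_δ`, because
`(δ, γ) = -1`. -/
theorem sq_mem_of_mul_mem {α δ : H.root} (hα : symMul (e α) (e δ) ∈ V) (h : cartanInt α δ = 1) :
    symMul (e δ) (e δ) ∈ V := by
  obtain ⟨γ, hγ⟩ := exists_root_eq_sub h
  rw [add_comm] at hγ
  have h1 : cartanInt α γ = 1 ∧ cartanInt δ γ = -1 := by
    have := cartanInt_of_eq_add α hγ
    have := cartanInt_of_eq_add γ hγ
    have := cartanInt_self α
    have := cartanInt_self γ
    have := hl α δ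
    have := hl α γ
    have := hl γ δ
    omega
  obtain ⟨c, hc, hce⟩ := hv.lie_f_e hl h1.1 hγ
  have hmem := V.lie_mem (x := f γ) hα
  rw [lie_symMul, hce, smul_symMul, hv.lie_f_e_eq_zero hl (by omega), symMul_zero,
    add_zero] at hmem
  exact mem_of_smul_mem hc hmem

theorem sq_mem_of_sq_mem {α δ : H.root} (hα : symMul (e α) (e α) ∈ V)
    (h : cartanInt α δ = 1 ∨ cartanInt α δ = -1) : symMul (e δ) (e δ) ∈ V := by
  have step {α δ : H.root} (hα : symMul (e α) (e α) ∈ V) (h : cartanInt α δ = 1) :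
      symMul (e δ) (e δ) ∈ V :=
    hv.sq_mem_of_mul_mem hl (hv.mul_mem_of_sq_mem hl hα h) h
  rcases h with h | h
  · exact step hα h
  -- The root `α + δ` pairs to `1` with both `α` and `δ`, so two steps suffice.
  obtain ⟨γ, hγ⟩ := hl.exists_root_eq_add h
  have h1 := cartanInt_of_eq_add α hγ
  have h2 := cartanInt_of_eq_add δ hγ
  have := cartanInt_self α
  have := cartanInt_self δ
  have := hl α δ
  have := hl α γ
  exact step (step (δ := γ) hα (by omega)) (by omega)

/-- In rank at least two the squares of all root vectors are obtained from one of them. -/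
theorem sq_mem (hrank : 2 ≤ finrank ℂ H) {ω : H.root} (hω : symMul (e ω) (e ω) ∈ V) (γ : H.root) :
    symMul (e γ) (e γ) ∈ V := by
  set S : Set H.root := {α | symMul (e α) (e α) ∈ V} with hS
  -- A root outside the span of `S` is orthogonal to `S`, so by irreducibility `S` spans and some
  -- member of `S` is not orthogonal to `γ`.
  have htop := (rootSystem H).span_root_image_eq_top_of_forall_orthogonal S ⟨ω, hω⟩ (by
    intro j hj i hi
    have hmem : (rootSystem H).root i ∈ Submodule.span ℂ ((rootSystem H).root '' S) :=
      Submodule.subset_span (Set.mem_image_of_mem _ hi)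
    have hjS : j ∉ S := fun h ↦ hj (Submodule.subset_span (Set.mem_image_of_mem _ h))
    rcases hl.mem_range i j with h | h | h | h | h
    · rw [← neg_eq_iff_eq_neg.mpr (hl.eq_neg_two_iff.mp h)] at hj
      exact absurd (Submodule.neg_mem _ hmem) hj
    · exact absurd (hv.sq_mem_of_sq_mem hl hi (.inr h)) hjS
    · refine ⟨?_, ?_⟩
      · rw [pairing_eq_cast, ← hl i j, h, Int.cast_zero]
      · rw [pairing_eq_cast, h, Int.cast_zero]
    · exact absurd (hv.sq_mem_of_sq_mem hl hi (.inl h)) hjS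
    · obtain rfl := hl.eq_two_iff.mp h
      exact absurd hi hjS)
  obtain ⟨α, hα, hne⟩ : ∃ α ∈ S, cartanInt α γ ≠ 0 := by
    by_contra! hcon
    have hle : Submodule.span ℂ ((rootSystem H).root '' S) ≤
        LinearMap.ker ((rootSystem H).coroot' γ) := by
      rw [Submodule.span_le]
      rintro _ ⟨α, hα, rfl⟩
      have := cast_cartanInt α γ
      rw [hcon α hα, Int.cast_zero] at this
      exact this.symm
    rw [htop] at hle
    have h0 : (rootSystem H).root γ ((rootSystem H).coroot γ) = 0 :=
      hle (x := (rootSystem H).root γ) trivial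
    rw [← cast_cartanInt, cartanInt_self] at h0
    norm_num at h0
  rcases hl.mem_range α γ with h | h | h | h | h
  -- Here `γ = -α`; the passage goes through a neighbour `β` of `α`, which pairs with `γ` to `-1`.
  · obtain ⟨β, hβ⟩ := exists_cartanInt_eq_one hl hrank α
    have h1 := cartanInt_of_eq_neg β (hl.eq_neg_two_iff.mp h)
    have := hl α β
    have := hl γ β
    exact hv.sq_mem_of_sq_mem hl (hv.sq_mem_of_sq_mem hl (δ := β) hα (.inl (by omega)))
      (.inr (by omega))
  · exact hv.sq_mem_of_sq_mem hl hα (.inr h)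
  · exact absurd h hne
  · exact hv.sq_mem_of_sq_mem hl hα (.inl h)
  · rwa [← hl.eq_two_iff.mp h]

/-- Lowering `e_α e_α` by `f_α` gives `-2 t_α e_α`. -/
theorem dualElt_mul_mem {α : H.root} (hα : symMul (e α) (e α) ∈ V) :
    symMul (dualElt H α : L) (e α) ∈ V := by
  have hmem := V.lie_mem (x := f α) hα
  rw [lie_symMul, ← lie_skew, hv.lie_e_f, symMul_comm (e α), ← two_smul ℂ, ← neg_one_smul ℂ,
    smul_symMul, smul_smul] at hmem
  exact mem_of_smul_mem (by norm_num) hmem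

/-- This is `f_α` applied to `t_α e_α`. Its root-vector part is a multiple of `f_α e_α`, the one
coordinate seen in weight zero. -/
theorem f_mul_sub_mem {α : H.root} (hα : symMul (e α) (e α) ∈ V) :
    (rootSystem H).root α (dualElt H α) • symMul (f α) (e α) -
      symMul (dualElt H α : L) (dualElt H α : L) ∈ V := by
  have hmem := V.lie_mem (x := f α) (hv.dualElt_mul_mem hl hα)
  rw [lie_symMul, ← lie_skew (f α) (e α), hv.lie_e_f, ← lie_skew,
    lie_eq_smul (hv.f_mem α)] at hmem
  convert! hmem using 1
  rw [LinearMap.neg_apply, neg_smul, neg_neg, smul_symMul, ← neg_one_smul ℂ (dualElt H α : L),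
    symMul_smul, neg_one_smul, sub_eq_add_neg]

/-- Apply `f_α` to `e_γ e_α`, using `[f_α, e_γ] = c e_β` and `[f_α, e_α] = -t_α`. The second term is
invisible to `coordMap`. -/
theorem mul_sub_dualElt_mem (hsq : ∀ α, symMul (e α) (e α) ∈ V) {α β γ : H.root}
    (h : cartanInt α β = -1)
    (hγ : (rootSystem H).root γ = (rootSystem H).root α + (rootSystem H).root β) :
    ∃ c : ℂ, c ≠ 0 ∧ c • symMul (e α) (e β) - symMul (dualElt H α : L) (e γ) ∈ V := by
  have h1 := cartanInt_of_eq_add α hγ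
  have := cartanInt_self α
  have := hl α β
  obtain ⟨c, hc, hce⟩ := hv.lie_f_e hl (α := γ) (γ := α) (δ := β) (by omega) hγ
  refine ⟨c, hc, ?_⟩
  have hmem := V.lie_mem (x := f α) (hv.mul_mem_of_sq_mem hl (hsq γ) (δ := α) (by omega))
  rw [lie_symMul, hce, ← lie_skew, hv.lie_e_f, ← neg_one_smul ℂ, symMul_smul, smul_symMul,
    symMul_comm (e β), symMul_comm (e γ), neg_one_smul, ← sub_eq_add_neg] at hmem
  exact hmem

/-- Put `ε = γ - α = β - δ`. Then `(γ, β) = 1`, so `e_γ e_β` lies in `V`, and `f_ε` lowers either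
`e_γ` to `e_α` or `e_β` to `e_δ`, up to nonzero scalars. -/
theorem mul_add_mul_mem (hsq : ∀ α, symMul (e α) (e α) ∈ V) {α β γ δ : H.root}
    (h0 : cartanInt α β = 0) (hαγ : α ≠ γ) (hαδ : α ≠ δ)
    (h : (rootSystem H).root α + (rootSystem H).root β =
      (rootSystem H).root γ + (rootSystem H).root δ) :
    ∃ c d : ℂ, c ≠ 0 ∧ d ≠ 0 ∧ c • symMul (e α) (e β) + d • symMul (e γ) (e δ) ∈ V := by
  have h0' := (hl.cartanInt_eq_of_add_eq h).symm.trans h0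
  have a1 := cartanInt_add α h
  have a2 := cartanInt_add β h
  have a3 := cartanInt_add γ h
  have := cartanInt_self α
  have := cartanInt_self β
  have := cartanInt_self γ
  have := hl α β
  have := hl γ δ
  have := hl α γ
  have := hl α δ
  have := hl β γ
  -- The pairings of `γ` and `δ` with `α` add up to `2`, and neither is `2`, as both roots differ
  -- from `α`.
  have hγα : cartanInt γ α = 1 := by
    have := hl.mem_range γ α
    have := hl.mem_range δ α
    have n1 : cartanInt γ α ≠ 2 := fun h ↦ hαγ (hl.eq_two_iff.mp h).symm
    have n2 : cartanInt δ α ≠ 2 := fun h ↦ hαδ (hl.eq_two_iff.mp h).symm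
    omega
  obtain ⟨ε, hε⟩ := exists_root_eq_sub hγα
  rw [add_comm] at hε
  have hε' : (rootSystem H).root β = (rootSystem H).root ε + (rootSystem H).root δ := by
    rw [hε] at h
    rw [← sub_eq_zero, ← sub_eq_zero_of_eq h]
    abel
  have c1 := cartanInt_of_eq_add γ hε
  have c2 := cartanInt_of_eq_add β hε'
  have c3 := cartanInt_of_eq_add β hε
  have := hl γ ε
  have := hl β ε
  have := hl β δ
  obtain ⟨c, hc, hce⟩ := hv.lie_f_e hl (α := γ) (γ := ε) (δ := α) (by omega) hε
  obtain ⟨d, hd, hde⟩ := hv.lie_f_e hl (α := β) (γ := ε) (δ := δ) (by omega) hε'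
  refine ⟨c, d, hc, hd, ?_⟩
  have hmem := V.lie_mem (x := f ε) (hv.mul_mem_of_sq_mem hl (hsq γ) (δ := β) (by omega))
  rwa [lie_symMul, hce, hde, smul_symMul, symMul_smul] at hmem

end RootVectors

end Generation

/-! ### Coordinates indexed by unordered pairs of roots -/

section Coordinates

variable {L : Type*} [LieRing L] [LieAlgebra ℂ L] [FiniteDimensional ℂ L] [IsSimple ℂ L]
variable {H : LieSubalgebra ℂ L} [H.IsCartanSubalgebra]

/-- The coordinates `dualForm t (f α) (f β)` for the unordered pairs `{α, β}` with sum `lam`. -/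
def coordMap (f : H.root → L) (lam : weightLattice H) :
    SymSquare L →ₗ[ℂ] (rootPairs H lam → ℂ) :=
  LinearMap.pi fun z ↦ Sym2.lift ⟨fun α β ↦
    LinearMap.applyₗ (f β) ∘ₗ LinearMap.applyₗ (f α) ∘ₗ dualForm L, fun α β ↦ by
      ext t
      exact dualForm_comm t (f α) (f β)⟩ z.1

theorem coordMap_apply (f : H.root → L) (lam : weightLattice H) (t : SymSquare L) (α β : H.root)
    (h : s(α, β) ∈ rootPairs H lam) :
    coordMap f lam t ⟨s(α, β), h⟩ = dualForm L t (f α) (f β) := rfl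

theorem mk_mem_rootPairs {lam : weightLattice H} {α β : H.root} : s(α, β) ∈ rootPairs H lam ↔
    (rootSystem H).root α + (rootSystem H).root β = (lam : Dual ℂ H) := by
  constructor
  · rintro ⟨γ, δ, h, hs⟩
    rcases Sym2.eq_iff.mp h with ⟨rfl, rfl⟩ | ⟨rfl, rfl⟩
    · exact hs
    · rwa [add_comm]
  · exact fun h ↦ ⟨α, β, rfl, h⟩

theorem numRootPairs_eq_finrank (lam : weightLattice H) :
    numRootPairs H lam = finrank ℂ (rootPairs H lam → ℂ) := by
  have : Fintype (rootPairs H lam) := Fintype.ofFinite _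
  rw [finrank_fintype_fun_eq_card, numRootPairs, Set.ncard_eq_toFinset_card', Set.toFinset_card]

theorem range_eq_top_of_single {ι E : Type*} [Finite ι] [DecidableEq ι] [AddCommGroup E]
    [Module ℂ E] (g : E →ₗ[ℂ] (ι → ℂ)) (h : ∀ i, Pi.single i 1 ∈ LinearMap.range g) :
    LinearMap.range g = ⊤ := by
  rw [eq_top_iff, ← (Pi.basisFun ℂ ι).span_eq, Submodule.span_le]
  rintro _ ⟨i, rfl⟩
  simpa using h i

theorem le_finrank_range_add_one {ι E : Type*} [Finite ι] [DecidableEq ι] [AddCommGroup E]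
    [Module ℂ E] (g : E →ₗ[ℂ] (ι → ℂ)) (i₀ : ι)
    (h : ∀ i, i ≠ i₀ → ∃ a b : ℂ, b ≠ 0 ∧
      a • Pi.single i₀ 1 + b • Pi.single i 1 ∈ LinearMap.range g) :
    finrank ℂ (ι → ℂ) ≤ finrank ℂ (LinearMap.range g) + 1 := by
  have htop : LinearMap.range g ⊔ Submodule.span ℂ {Pi.single i₀ (1 : ℂ)} = ⊤ := by
    rw [eq_top_iff, ← (Pi.basisFun ℂ ι).span_eq, Submodule.span_le]
    rintro _ ⟨i, rfl⟩
    have h0 : (Pi.single i₀ 1 : ι → ℂ) ∈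
        LinearMap.range g ⊔ Submodule.span ℂ {Pi.single i₀ (1 : ℂ)} :=
      Submodule.mem_sup_right (Submodule.mem_span_singleton_self _)
    rw [Pi.basisFun_apply, SetLike.mem_coe]
    by_cases hi : i = i₀
    · rwa [hi]
    obtain ⟨a, b, hb, hab⟩ := h i hi
    have h1 := Submodule.sub_mem _ (Submodule.mem_sup_left hab) (Submodule.smul_mem _ a h0)
    rw [add_sub_cancel_left] at h1
    exact (Submodule.smul_mem_iff _ hb).mp h1
  rw [← finrank_top ℂ (ι → ℂ), ← htop]
  exact (Submodule.finrank_add_le_finrank_add_finrank _ _).trans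
    (Nat.add_le_add_left ((finrank_span_le_card _).trans (by simp)) _)

namespace RootVectors

variable {e f : H.root → L} (hv : RootVectors e f)
include hv

theorem coordMap_symMul_e [DecidableEq H.root] {lam : weightLattice H} {α β : H.root}
    (h : s(α, β) ∈ rootPairs H lam) :
    ∃ a : ℂ, a ≠ 0 ∧
      coordMap f lam (symMul (e α) (e β)) = a • Pi.single ⟨s(α, β), h⟩ 1 := by
  -- For a square both summands of `dualForm` contribute, hence the `2`.
  refine ⟨if α = β then 2 else 1, by split_ifs <;> norm_num, ?_⟩
  ext ⟨z, hz⟩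
  induction z with | h γ δ => ?_
  rw [coordMap_apply, hv.dualForm_symMul_e, Pi.smul_apply, Pi.single_apply]
  simp only [Subtype.mk.injEq, Sym2.eq_iff]
  split_ifs <;> first | (norm_num; done) | (exfalso; grind)

theorem coordMap_symMul_coe (lam : weightLattice H) (h : H) (x : L) :
    coordMap f lam (symMul (h : L) x) = 0 := by
  ext ⟨z, hz⟩
  induction z with | h γ δ => ?_
  rw [coordMap_apply, hv.dualForm_symMul_coe]
  rfl

variable {lam : weightLattice H} {t : SymSquare L}
variable (ht : ∀ h : H, ⁅(h : L), t⁆ = (lam : Dual ℂ H) h • t)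
include ht

theorem dualForm_f_f_eq_zero (h0 : coordMap f lam t = 0) (α β : H.root) :
    dualForm L t (f α) (f β) = 0 := by
  by_cases h : (rootSystem H).root α + (rootSystem H).root β = (lam : Dual ℂ H)
  · rw [← coordMap_apply f lam t α β (mk_mem_rootPairs.mpr h), h0]
    rfl
  · refine dualForm_eq_zero ht (hv.f_mem α) (hv.f_mem β) fun h' ↦ h ?_
    rw [← sub_eq_zero, ← neg_eq_zero, ← h']
    abel

theorem dualForm_coe_f_eq_zero (h : H) {β : H.root}
    (hβ : (rootSystem H).root β ≠ (lam : Dual ℂ H)) : dualForm L t (h : L) (f β) = 0 := by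
  refine dualForm_eq_zero ht (coe_mem_rootSpace_zero h) (hv.f_mem β) fun h' ↦ hβ ?_
  rw [← sub_eq_zero, ← neg_eq_zero, ← h']
  abel

theorem dualForm_coe_coe_eq_zero (h h' : H) (h0 : lam ≠ 0) :
    dualForm L t (h : L) (h' : L) = 0 := by
  refine dualForm_eq_zero ht (coe_mem_rootSpace_zero h) (coe_mem_rootSpace_zero h') fun h' ↦ h0 ?_
  simpa using h'

theorem eq_zero_of_coordMap (h0 : lam ≠ 0)
    (hlam : ∀ α, (rootSystem H).root α ≠ (lam : Dual ℂ H)) (hc : coordMap f lam t = 0) : t = 0 :=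
  hv.ext_dualForm
    (fun α β ↦ by rw [hv.dualForm_f_f_eq_zero ht hc]; simp)
    (fun h β ↦ by rw [hv.dualForm_coe_f_eq_zero ht h (hlam β)]; simp)
    (fun h h' ↦ by rw [hv.dualForm_coe_coe_eq_zero ht h h' h0]; simp)

theorem eq_symMul_of_coordMap {lam₀ : H.root} (hlam : (rootSystem H).root lam₀ = (lam : Dual ℂ H))
    (hc : coordMap f lam t = 0) : ∃ h : H, t = symMul (h : L) (e lam₀) := by
  classical
  have h0 : lam ≠ 0 := fun h ↦ (rootSystem H).ne_zero lam₀ (by rw [hlam, h]; rfl)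
  -- The only block left pairs `H` with `f lam₀`; the required `h` is the Killing dual of this
  -- functional.
  let g : Dual ℂ H := (dualForm L t).flip (f lam₀) ∘ₗ H.toSubmodule.subtype
  refine ⟨(cartanEquivDual H).symm g, ?_⟩
  have hg (h : H) : killingForm ℂ L ((cartanEquivDual H).symm g : L) h =
      dualForm L t (h : L) (f lam₀) :=
    DFunLike.congr_fun ((cartanEquivDual H).apply_symm_apply g) h
  refine hv.ext_dualForm (fun α β ↦ ?_) (fun h β ↦ ?_) fun h h' ↦ ?_
  · rw [hv.dualForm_f_f_eq_zero ht hc, hv.dualForm_symMul_coe]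
  · rw [dualForm_symMul, hv.killing_coe_f, hg, hv.killing_e_f, zero_mul, add_zero]
    split_ifs with h'
    · rw [h', mul_one]
    · rw [mul_zero]
      exact hv.dualForm_coe_f_eq_zero ht h fun h'' ↦
        h' ((rootSystem H).root.injective (hlam.trans h''.symm))
  · rw [hv.dualForm_coe_coe_eq_zero ht h h' h0, dualForm_symMul, hv.killing_e_coe,
      hv.killing_e_coe, mul_zero, mul_zero, add_zero]

/-- With no root-vector coordinates, `t` lives on `H × H` only. Then `symAd h h' t = 0`, and the
trace identity reduces to `c * dualForm L t h h' = 0`. -/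
theorem eq_zero_of_coordMap_zero (h0 : lam = 0) (hc : coordMap f lam t = 0) {c : ℂ} (hc0 : c ≠ 0)
    (hcon : contraction L c t = 0) : t = 0 := by
  have hz : (lam : Dual ℂ H) = 0 := by rw [h0]; rfl
  have h2 (h : H) (β) : dualForm L t (h : L) (f β) = 0 :=
    hv.dualForm_coe_f_eq_zero ht h (by rw [hz]; exact (rootSystem H).ne_zero β)
  have hf (α : H.root) : dualForm L t (f α) = 0 :=
    hv.linearMap_eq_zero _ (fun h ↦ by rw [dualForm_comm, h2])
      fun β ↦ hv.dualForm_f_f_eq_zero ht hc α β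
  have had (h : H) (u : L) : dualForm L t ⁅(h : L), u⁆ = 0 := by
    have : dualForm L t ∘ₗ ad ℂ L (h : L) = 0 := by
      refine hv.linearMap_eq_zero _ (fun h' ↦ ?_) fun α ↦ ?_
      · have : ⁅(h : L), (h' : L)⁆ = 0 := by
          rw [lie_eq_smul (coe_mem_rootSpace_zero h')]; simp
        simp [this]
      · simp [lie_eq_smul (hv.f_mem α), hf]
    exact LinearMap.congr_fun this u
  refine hv.ext_dualForm (fun α β ↦ ?_) (fun h β ↦ ?_) fun h h' ↦ ?_
  · rw [hv.dualForm_f_f_eq_zero ht hc]; simp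
  · rw [h2]; simp
  · have hs : symAd (h : L) (h' : L) t = 0 := by
      refine eq_zero_of_dualForm_eq_zero fun u v ↦ ?_
      rw [dualForm_symAd, had, had]; simp
    have := killingForm_contraction c t (h : L) (h' : L)
    rw [hcon, hs] at this
    simpa [hc0] using this

end RootVectors

end Coordinates

/-! ### The weight multiplicities, case by case -/

section Multiplicities

variable {L : Type*} [LieRing L] [LieAlgebra ℂ L] [FiniteDimensional ℂ L] [IsSimple ℂ L]
variable {H : LieSubalgebra ℂ L} [H.IsCartanSubalgebra]

namespace RootVectors

variable {e f : H.root → L} (hv : RootVectors e f)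
include hv

theorem symMul_e_weight {lam : weightLattice H} {α β : H.root}
    (h : (rootSystem H).root α + (rootSystem H).root β = (lam : Dual ℂ H)) (x : H) :
    ⁅(x : L), symMul (e α) (e β)⁆ = (lam : Dual ℂ H) x • symMul (e α) (e β) := by
  rw [← h]
  exact symMul_weight (hv.e_mem α) (hv.e_mem β) x

theorem dualElt_mul_e_weight {lam : weightLattice H} (α : H.root) {β : H.root}
    (h : (rootSystem H).root β = (lam : Dual ℂ H)) (x : H) :
    ⁅(x : L), symMul (dualElt H α : L) (e β)⁆ =
      (lam : Dual ℂ H) x • symMul (dualElt H α : L) (e β) := by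
  rw [symMul_weight (coe_mem_rootSpace_zero _) (hv.e_mem β), zero_add, h]

/-- Evaluating the contraction at `f_α` gives `-α(h) t_α - c h = 0`, so `h` is a multiple of `t_α`.
-/
theorem contraction_dualElt_mul {c : ℂ} (hc : c ≠ 0) {h : H} {α : H.root}
    (h0 : contraction L c (symMul (h : L) (e α)) = 0) :
    symMul (h : L) (e α) ∈ Submodule.span ℂ {symMul (dualElt H α : L) (e α)} := by
  have := LinearMap.congr_fun h0 (f α)
  rw [contraction_symMul, hv.lie_e_f, hv.killing, hv.killing_coe_f, lie_eq_smul (hv.f_mem α),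
    lie_smul, hv.lie_e_f, lie_eq_smul (coe_mem_rootSpace_zero _)] at this
  simp only [LinearMap.zero_apply, zero_smul, zero_add, one_smul, LinearMap.neg_apply] at this
  have hh : (h : L) = (c⁻¹ * -(rootSystem H).root α h) • (dualElt H α : L) := by
    rw [mul_smul, sub_eq_zero.mp this, inv_smul_smul₀ hc]
  rw [hh, smul_symMul]
  exact Submodule.smul_mem _ _ (Submodule.mem_span_singleton_self _)

/-- At `f_α` both double brackets vanish by orthogonality, and `-c e_β` remains. -/
theorem contraction_mul_ne_zero {c : ℂ} (hc : c ≠ 0) (hl : IsLaced H) {α β : H.root}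
    (h : cartanInt α β = 0) : contraction L c (symMul (e α) (e β)) ≠ 0 := fun h0 ↦ by
  classical
  have := LinearMap.congr_fun h0 (f α)
  have hne : β ≠ α := by rintro rfl; simp at h
  have h1 : ⁅e β, f α⁆ = 0 := by
    rw [← lie_skew, hv.lie_f_e_eq_zero hl (by rw [hl]; exact h.le), neg_zero]
  have h2 : ⁅e β, (dualElt H α : L)⁆ = 0 := by
    have h3 := two_mul_root_dualElt α β
    rw [← hl α β, h] at h3
    rw [← lie_skew, lie_eq_smul (hv.e_mem β), show (rootSystem H).root β (dualElt H α) = 0 by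
      simpa using h3]
    simp
  rw [contraction_symMul, h1, hv.lie_e_f, h2, hv.killing, hv.killing_e_f, if_neg hne] at this
  simp [hc, hv.e_ne_zero] at this

theorem contraction_sq (hl : IsLaced H) (α : H.root) :
    contraction L (-(rootSystem H).root α (dualElt H α)) (symMul (e α) (e α)) = 0 := by
  ext z
  rw [contraction_symMul, hv.lie_e_lie_e hl]
  simp only [LinearMap.zero_apply]
  module

variable (hl : IsLaced H) (V : LieSubmodule ℂ L (SymSquare L))
variable (hsq : ∀ α, symMul (e α) (e α) ∈ V) {c : ℂ} (hc : c ≠ 0)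
  (hV : ∀ t ∈ V, contraction L c t = 0) (lam : weightLattice H)
include hl hsq hc hV

/-- The coordinates are onto by `mul_sub_dualElt_mem`. Their kernel consists of products `h e_λ`,
which the contraction restricts to the line of `t_λ e_λ`. -/
theorem finrank_weightPart_root {lam₀ : H.root}
    (hlam : (rootSystem H).root lam₀ = (lam : Dual ℂ H)) :
    finrank ℂ (weightPart V (lam : Dual ℂ H)) = numRootPairs H lam + 1 := by
  classical
  set g := (coordMap f lam).domRestrict (weightPart V (lam : Dual ℂ H)) with hg
  have hrange : LinearMap.range g = ⊤ := by
    refine range_eq_top_of_single g ?_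
    rintro ⟨z, hz⟩
    induction z with | h α β => ?_
    have hsum := mk_mem_rootPairs.mp hz
    have hab : cartanInt α β = -1 := by
      have h0 := hlam.trans hsum.symm
      have h1 := cartanInt_of_eq_add α h0
      have h2 := cartanInt_of_eq_add β h0
      have h3 := cartanInt_of_eq_add lam₀ h0
      have := hl α β
      have := hl α lam₀
      have := hl β lam₀
      have := cartanInt_self α
      have := cartanInt_self β
      have := cartanInt_self lam₀
      omega
    obtain ⟨a, ha, hca⟩ := hv.coordMap_symMul_e hz
    obtain ⟨d, hd, hmem⟩ := hv.mul_sub_dualElt_mem hl hsq hab (hlam.trans hsum.symm)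
    have hw : d • symMul (e α) (e β) - symMul (dualElt H α : L) (e lam₀) ∈
        weightPart V (lam : Dual ℂ H) := by
      refine ⟨hmem, fun x ↦ ?_⟩
      rw [lie_sub, lie_smul, hv.symMul_e_weight hsum, hv.dualElt_mul_e_weight α hlam, smul_sub,
        smul_comm]
    have hval : g ⟨_, hw⟩ = (d * a) • Pi.single ⟨s(α, β), hz⟩ 1 := by
      rw [hg, LinearMap.domRestrict_apply, map_sub, map_smul, hca, hv.coordMap_symMul_coe,
        sub_zero, smul_smul]
    exact (Submodule.smul_mem_iff _ (mul_ne_zero hd ha)).mp ⟨_, hval⟩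
  have hlw : symMul (dualElt H lam₀ : L) (e lam₀) ∈ weightPart V (lam : Dual ℂ H) :=
    ⟨hv.dualElt_mul_mem hl (hsq lam₀), hv.dualElt_mul_e_weight lam₀ hlam⟩
  have hker : LinearMap.ker g = Submodule.span ℂ {⟨_, hlw⟩} := by
    apply le_antisymm
    · rintro ⟨t, ht⟩ hgt
      obtain ⟨h, rfl⟩ := hv.eq_symMul_of_coordMap ht.2 hlam hgt
      obtain ⟨a, ha⟩ := Submodule.mem_span_singleton.mp
        (hv.contraction_dualElt_mul hc (hV _ ht.1))
      exact Submodule.mem_span_singleton.mpr ⟨a, Subtype.ext ha⟩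
    · rw [Submodule.span_singleton_le_iff_mem, LinearMap.mem_ker, hg,
        LinearMap.domRestrict_apply, hv.coordMap_symMul_coe]
  have hne : (⟨_, hlw⟩ : weightPart V (lam : Dual ℂ H)) ≠ 0 := fun h ↦ by
    have h0 : symMul (dualElt H lam₀ : L) (e lam₀) = 0 := congrArg Subtype.val h
    have := dualForm_symMul (dualElt H lam₀ : L) (e lam₀) (dualElt H lam₀ : L) (f lam₀)
    rw [h0, hv.killing, hv.killing_coe_f, killingForm_dualElt] at this
    simp only [map_zero, LinearMap.zero_apply, mul_one, zero_mul, add_zero] at this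
    exact root_dualElt_self_ne_zero lam₀ this.symm
  have := g.finrank_range_add_finrank_ker
  rw [hrange, hker, finrank_top, finrank_span_singleton hne, ← numRootPairs_eq_finrank] at this
  exact this.symm

theorem finrank_weightPart_zero (hlam : lam = 0) :
    finrank ℂ (weightPart V (lam : Dual ℂ H)) = numRootPairs H lam := by
  classical
  have hz : (lam : Dual ℂ H) = 0 := by rw [hlam]; rfl
  set g := (coordMap f lam).domRestrict (weightPart V (lam : Dual ℂ H)) with hg
  have hrange : LinearMap.range g = ⊤ := by
    refine range_eq_top_of_single g ?_
    rintro ⟨z, hz'⟩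
    induction z with | h α β => ?_
    have hsum := mk_mem_rootPairs.mp hz'
    have hα : (rootSystem H).root β = -(rootSystem H).root α :=
      eq_neg_of_add_eq_zero_right (hsum.trans hz)
    obtain ⟨a, ha, hca⟩ := hv.coordMap_symMul_e hz'
    have hmem := hv.f_mul_sub_mem hl (hsq α)
    -- Since `β = -α`, the vector `f α` is a nonzero multiple of `e β`.
    have hfm := hv.f_mem α
    rw [← hα] at hfm
    have hfe := hv.eq_smul_e hfm
    set d := killingForm ℂ L (f α) (f β)
    have hd : d ≠ 0 := fun h ↦ hv.f_ne_zero α (by rw [hfe, h, zero_smul])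
    rw [hfe, smul_symMul, symMul_comm (e β)] at hmem
    have hw := (mem_weightPart (χ := (lam : Dual ℂ H))).mpr ⟨hmem, fun x ↦ by
      rw [lie_sub, lie_smul, lie_smul, hv.symMul_e_weight hsum,
        symMul_weight (coe_mem_rootSpace_zero _) (coe_mem_rootSpace_zero _), hz]
      simp⟩
    have hval : g ⟨_, hw⟩ =
        ((rootSystem H).root α (dualElt H α) * d * a) • Pi.single ⟨s(α, β), hz'⟩ 1 := by
      rw [hg, LinearMap.domRestrict_apply, map_sub, map_smul, map_smul, hca,
        hv.coordMap_symMul_coe, sub_zero, smul_smul, smul_smul, mul_assoc]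
    exact (Submodule.smul_mem_iff _
      (mul_ne_zero (mul_ne_zero (root_dualElt_self_ne_zero α) hd) ha)).mp ⟨_, hval⟩
  have hinj : Function.Injective g := by
    rw [injective_iff_map_eq_zero]
    rintro ⟨t, ht⟩ hgt
    exact Subtype.ext (hv.eq_zero_of_coordMap_zero ht.2 hlam hgt hc (hV _ ht.1))
  rw [numRootPairs_eq_finrank, ← finrank_top ℂ (rootPairs H lam → ℂ), ← hrange,
    LinearMap.finrank_range_of_inj hinj]

/-- The coordinates are injective. They miss the vector of `e_α e_β`, which would otherwise lie in
`V` against `contraction_mul_ne_zero`; the binomials of `mul_add_mul_mem` show that the defect is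
exactly one. -/
theorem finrank_weightPart_orthogonal (h0 : lam ≠ 0)
    (hlam : ∀ α, (rootSystem H).root α ≠ (lam : Dual ℂ H)) {α β : H.root}
    (hαβ : cartanInt α β = 0)
    (hsum : (rootSystem H).root α + (rootSystem H).root β = (lam : Dual ℂ H)) :
    finrank ℂ (weightPart V (lam : Dual ℂ H)) + 1 = numRootPairs H lam := by
  classical
  set g := (coordMap f lam).domRestrict (weightPart V (lam : Dual ℂ H)) with hg
  have hinj : Function.Injective g := by
    rw [injective_iff_map_eq_zero]
    rintro ⟨t, ht⟩ hgt
    exact Subtype.ext (hv.eq_zero_of_coordMap ht.2 h0 hlam hgt)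
  have hmem := mk_mem_rootPairs.mpr hsum
  have hlt : finrank ℂ (LinearMap.range g) < finrank ℂ (rootPairs H lam → ℂ) := by
    refine Submodule.finrank_lt fun htop ↦ ?_
    obtain ⟨⟨t, ht⟩, htg⟩ : coordMap f lam (symMul (e α) (e β)) ∈ LinearMap.range g := by
      rw [htop]; trivial
    have h1 : t - symMul (e α) (e β) = 0 := by
      refine hv.eq_zero_of_coordMap (fun x ↦ ?_) h0 hlam ?_
      · rw [lie_sub, ht.2, hv.symMul_e_weight hsum, smul_sub]
      · rw [map_sub, sub_eq_zero]; exact htg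
    rw [sub_eq_zero] at h1
    exact hv.contraction_mul_ne_zero hc hl hαβ (h1 ▸ hV t ht.1)
  have hge := le_finrank_range_add_one g ⟨s(α, β), hmem⟩ (by
    rintro ⟨z, hz⟩ hne
    induction z with | h γ δ => ?_
    have hsum' := mk_mem_rootPairs.mp hz
    have hne' : ¬ s(γ, δ) = s(α, β) := fun h ↦ hne (Subtype.ext h)
    rw [Sym2.eq_iff, not_or] at hne'
    have e1 := hsum.trans hsum'.symm
    have hαγ : α ≠ γ := by
      rintro rfl
      exact hne'.1 ⟨rfl, (rootSystem H).root.injective (add_left_cancel e1).symm⟩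
    have hαδ : α ≠ δ := by
      rintro rfl
      rw [add_comm (((rootSystem H).root) γ)] at e1
      exact hne'.2 ⟨(rootSystem H).root.injective (add_left_cancel e1).symm, rfl⟩
    obtain ⟨a, b, -, hb, hab⟩ := hv.mul_add_mul_mem hl hsq hαβ hαγ hαδ e1
    obtain ⟨a', -, ha'⟩ := hv.coordMap_symMul_e hmem
    obtain ⟨b', hb', hbe⟩ := hv.coordMap_symMul_e hz
    have hw := (mem_weightPart (χ := (lam : Dual ℂ H))).mpr ⟨hab, fun x ↦ by
      rw [lie_add, lie_smul, lie_smul, hv.symMul_e_weight hsum, hv.symMul_e_weight hsum',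
        smul_add, smul_comm a, smul_comm b]⟩
    refine ⟨a * a', b * b', mul_ne_zero hb hb', ⟨_, hw⟩, ?_⟩
    rw [hg, LinearMap.domRestrict_apply, map_add, map_smul, map_smul, ha', hbe, smul_smul,
      smul_smul])
  rw [← LinearMap.finrank_range_of_inj hinj, numRootPairs_eq_finrank]
  omega

theorem finrank_weightPart_one (h0 : lam ≠ 0)
    (hlam : ∀ α, (rootSystem H).root α ≠ (lam : Dual ℂ H)) {α β : H.root}
    (hαβ : cartanInt α β = 1 ∨ cartanInt α β = 2)
    (hsum : (rootSystem H).root α + (rootSystem H).root β = (lam : Dual ℂ H)) :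
    finrank ℂ (weightPart V (lam : Dual ℂ H)) = 1 := by
  classical
  set g := (coordMap f lam).domRestrict (weightPart V (lam : Dual ℂ H)) with hg
  have hinj : Function.Injective g := by
    rw [injective_iff_map_eq_zero]
    rintro ⟨t, ht⟩ hgt
    exact Subtype.ext (hv.eq_zero_of_coordMap ht.2 h0 hlam hgt)
  have hn : rootPairs H lam = {s(α, β)} := by
    refine Set.eq_singleton_iff_unique_mem.mpr ⟨mk_mem_rootPairs.mpr hsum, fun z hz ↦ ?_⟩
    induction z with | h γ δ => ?_
    have e1 := hsum.trans (mk_mem_rootPairs.mp hz).symm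
    have a1 := cartanInt_add α e1
    have := cartanInt_self α
    have := hl α β
    -- Here `γ` and `δ` pair with `α` to a total of `3` or `4`, so one of them is `α` and the pair
    -- is unique.
    have hcases : cartanInt γ α = 2 ∨ cartanInt δ α = 2 := by
      have := hl.mem_range γ α
      have := hl.mem_range δ α
      omega
    rcases hcases with h | h
    · obtain rfl := hl.eq_two_iff.mp h
      rw [(rootSystem H).root.injective (add_left_cancel e1)]
    · obtain rfl := hl.eq_two_iff.mp h
      rw [add_comm (((rootSystem H).root) γ)] at e1
      rw [(rootSystem H).root.injective (add_left_cancel e1), Sym2.eq_swap]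
  have hle : finrank ℂ (weightPart V (lam : Dual ℂ H)) ≤ 1 := by
    refine (LinearMap.finrank_le_finrank_of_injective hinj).trans ?_
    rw [← numRootPairs_eq_finrank, numRootPairs, hn, Set.ncard_singleton]
  have hmem : symMul (e α) (e β) ∈ V := by
    rcases hαβ with h | h
    · exact hv.mul_mem_of_sq_mem hl (hsq α) h
    · rw [← hl.eq_two_iff.mp h]; exact hsq α
  have : Nontrivial (weightPart V (lam : Dual ℂ H)) :=
    ⟨⟨_, hmem, hv.symMul_e_weight hsum⟩, 0, fun h ↦
      hv.symMul_e_e_ne_zero α β (congrArg Subtype.val h)⟩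
  have := finrank_pos (R := ℂ) (M := weightPart V (lam : Dual ℂ H))
  omega

theorem finrank_weightPart_eq_zero (h0 : lam ≠ 0)
    (hlam : ∀ α, (rootSystem H).root α ≠ (lam : Dual ℂ H))
    (hsum : ∀ α β, (rootSystem H).root α + (rootSystem H).root β ≠ (lam : Dual ℂ H)) :
    finrank ℂ (weightPart V (lam : Dual ℂ H)) = 0 := by
  have : weightPart V (lam : Dual ℂ H) = ⊥ := by
    refine (Submodule.eq_bot_iff _).mpr fun t ht ↦ hv.eq_zero_of_coordMap ht.2 h0 hlam ?_
    ext ⟨z, hz⟩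
    induction z with | h γ δ => ?_
    exact absurd (mk_mem_rootPairs.mp hz) (hsum γ δ)
  rw [this, finrank_bot]

end RootVectors

end Multiplicities

/-! ### The sets `Λ_i` and the assembled multiplicity formula -/

section WeightSets

variable {L : Type*} [LieRing L] [LieAlgebra ℂ L] [FiniteDimensional ℂ L] [IsSimple ℂ L]
variable {H : LieSubalgebra ℂ L} [H.IsCartanSubalgebra]

theorem kappa_eq_cast (α β : H.root) : kappa H α β = cartanInt α β := by
  have hne := root_dualElt_self_ne_zero α
  have h (x : H) : killingForm ℂ L ((rootSystem H).coroot α) x =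
      2 * ((rootSystem H).root α (dualElt H α))⁻¹ * (rootSystem H).root α x := by
    have hcoe (a : ℂ) : ((a • dualElt H α : H) : L) = a • (dualElt H α : L) := rfl
    rw [coroot_eq_smul_dualElt, hcoe, map_smul, LinearMap.smul_apply,
      killingForm_dualElt, smul_eq_mul]
  rw [kappa, h, h, ← cast_cartanInt, ← cast_cartanInt, cartanInt_self]
  field_simp
  norm_num

theorem mem_weightSet {i : ℤ} {lam : weightLattice H} : lam ∈ weightSet H i ↔
    ∃ α β : H.root, cartanInt α β = i ∧
      (rootSystem H).root α + (rootSystem H).root β = (lam : Dual ℂ H) := by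
  simp only [weightSet, Set.mem_ofPred_eq, kappa_eq_cast, Int.cast_inj]
  simp only [eq_comm]

theorem IsLaced.cartanInt_eq_of_mem_weightSet (hl : IsLaced H) {i : ℤ} {lam : weightLattice H}
    (h : lam ∈ weightSet H i) {α β : H.root}
    (hs : (rootSystem H).root α + (rootSystem H).root β = (lam : Dual ℂ H)) :
    cartanInt α β = i := by
  obtain ⟨γ, δ, rfl, hs'⟩ := mem_weightSet.mp h
  exact hl.cartanInt_eq_of_add_eq (hs.trans hs'.symm)

/-- Conversely, a root `α` with a neighbour `β` splits as `β + (α - β)`, with pairing `1 - 2 = -1`.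
The neighbour is where rank at least two enters. -/
theorem IsLaced.mem_weightSet_neg_one_iff (hl : IsLaced H) (hrank : 2 ≤ finrank ℂ H)
    {lam : weightLattice H} :
    lam ∈ weightSet H (-1) ↔ ∃ α, (rootSystem H).root α = (lam : Dual ℂ H) := by
  rw [mem_weightSet]
  constructor
  · rintro ⟨α, β, h, hs⟩
    obtain ⟨γ, hγ⟩ := hl.exists_root_eq_add h
    exact ⟨γ, hγ.trans hs⟩
  · rintro ⟨α, hα⟩
    obtain ⟨β, hβ⟩ := exists_cartanInt_eq_one hl hrank α
    obtain ⟨γ, hγ⟩ := exists_root_eq_sub ((hl α β).trans hβ)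
    have := cartanInt_of_eq_add β hγ
    have := cartanInt_self β
    have := hl α β
    have := hl β γ
    exact ⟨β, γ, by omega, hγ.symm.trans hα⟩

theorem IsLaced.eq_zero_iff (hl : IsLaced H) {lam : weightLattice H} {α β : H.root}
    (hs : (rootSystem H).root α + (rootSystem H).root β = (lam : Dual ℂ H)) :
    lam = 0 ↔ cartanInt α β = -2 := by
  rw [hl.eq_neg_two_iff, ← add_eq_zero_iff_eq_neg, hs, ← AddSubgroup.coe_zero (weightLattice H),
    SetLike.coe_eq_coe]

open Classical in
theorem RootVectors.finrank_weightPart_eq {e f : H.root → L} (hv : RootVectors e f)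
    (hl : IsLaced H) (V : LieSubmodule ℂ L (SymSquare L))
    (hsq : ∀ α, symMul (e α) (e α) ∈ V) {c : ℂ} (hc : c ≠ 0)
    (hV : ∀ t ∈ V, contraction L c t = 0) (lam : weightLattice H) (ω : H.root)
    (hrank : 2 ≤ finrank ℂ H) :
    (finrank ℂ (weightPart V (lam : Dual ℂ H)) : ℤ) =
      (if lam = 0 then (numRootPairs H 0 : ℤ) else 0) +
      (if lam ∈ weightSet H (-1) then (numRootPairs H lam : ℤ) + 1 else 0) +
      (if lam ∈ weightSet H 0 then (numRootPairs H lam : ℤ) - 1 else 0) +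
      (if lam ∈ weightSet H 1 ∨ lam ∈ weightSet H 2 then 1 else 0) := by
  have hdis {i : ℤ} (h : lam ∈ weightSet H i) (j : ℤ) : lam ∈ weightSet H j ↔ j = i := by
    refine ⟨fun h' ↦ ?_, fun h' ↦ h' ▸ h⟩
    obtain ⟨γ, δ, rfl, hs⟩ := mem_weightSet.mp h'
    exact hl.cartanInt_eq_of_mem_weightSet h hs
  by_cases hsum : ∃ α β : H.root,
    (rootSystem H).root α + (rootSystem H).root β = (lam : Dual ℂ H)
  · obtain ⟨α, β, hs⟩ := hsum
    have hmem : lam ∈ weightSet H (cartanInt α β) := mem_weightSet.mpr ⟨α, β, rfl, hs⟩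
    have h0 := hl.eq_zero_iff hs
    have hroot := hl.mem_weightSet_neg_one_iff hrank (lam := lam)
    simp only [hdis hmem, h0] at hroot ⊢
    rcases hl.mem_range α β with h | h | h | h | h <;> rw [h] at h0 hroot ⊢
    · have hz := h0.mpr rfl
      rw [hv.finrank_weightPart_zero hl V hsq hc hV lam hz, hz]
      simp
    · obtain ⟨lam₀, hlam⟩ := hroot.mp rfl
      rw [hv.finrank_weightPart_root hl V hsq hc hV lam hlam]
      simp
    · have := hv.finrank_weightPart_orthogonal hl V hsq hc hV lam (by simp [h0])
        (by simpa using hroot) h hs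
      rw [← this]
      simp
    · rw [hv.finrank_weightPart_one hl V hsq hc hV lam (by simp [h0])
        (by simpa using hroot) (.inl h) hs]
      simp
    · rw [hv.finrank_weightPart_one hl V hsq hc hV lam (by simp [h0])
        (by simpa using hroot) (.inr h) hs]
      simp
  · have hno (i : ℤ) : lam ∉ weightSet H i := fun h ↦ by
      obtain ⟨α, β, -, hs⟩ := mem_weightSet.mp h
      exact hsum ⟨α, β, hs⟩
    have h0 : lam ≠ 0 := by
      rintro rfl
      -- Zero is the sum of `ω` and `-ω`, the reflection of `ω` in itself.
      refine hsum ⟨ω, (rootSystem H).reflectionPerm ω ω, ?_⟩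
      rw [(rootSystem H).root_reflectionPerm, (rootSystem H).reflection_apply_self]
      simp
    have hroot := hl.mem_weightSet_neg_one_iff hrank (lam := lam)
    rw [hv.finrank_weightPart_eq_zero hl V hsq hc hV lam h0
      (fun α hα ↦ hno _ (hroot.mpr ⟨α, hα⟩)) fun α β h ↦ hsum ⟨α, β, h⟩]
    simp [hno, h0]

end WeightSets

/-! ### The character of the generated subrepresentation -/

theorem symMul_self_mem_squareSubrep {L : Type*} [LieRing L] [LieAlgebra ℂ L] (x : L) :
    symMul x x ∈ squareSubrep x :=
  LieSubmodule.subset_lieSpan (Set.mem_singleton _)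

theorem squareSubrep_le {L : Type*} [LieRing L] [LieAlgebra ℂ L] {x : L}
    {V : LieSubmodule ℂ L (SymSquare L)} (h : symMul x x ∈ V) : squareSubrep x ≤ V :=
  LieSubmodule.lieSpan_le.mpr (Set.singleton_subset_iff.mpr h)

theorem coeff_formalCharacter {L : Type*} [LieRing L] [LieAlgebra ℂ L] [FiniteDimensional ℂ L]
    [IsSimple ℂ L] (H : LieSubalgebra ℂ L) [H.IsCartanSubalgebra]
    (V : LieSubmodule ℂ L (SymSquare L)) (lam : weightLattice H) :
    (formalCharacter H V).coeff lam = (finrank ℂ (weightPart V (lam : Dual ℂ H)) : ℤ) := by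
  rw [← finrank_weightSpace_eq]
  rfl

theorem coeff_sum_single {M : Type*} [DecidableEq M] (s : Finset M) (g : M → ℤ) (m : M) :
    (∑ x ∈ s, AddMonoidAlgebra.single x (g x)).coeff m = if m ∈ s then g m else 0 := by
  rw [AddMonoidAlgebra.coeff_sum, Finsupp.finsetSum_apply]
  simp [AddMonoidAlgebra.coeff_single, Finsupp.single_apply]

end SimplyLacedCharacter

end

open SimplyLacedCharacter in
theorem mainTheorem5 {L : Type*} [LieRing L] [LieAlgebra ℂ L] [FiniteDimensional ℂ L]
    [LieAlgebra.IsSimple ℂ L] (H : LieSubalgebra ℂ L) [H.IsCartanSubalgebra]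
    (b : (LieAlgebra.IsKilling.rootSystem H).Base)
    (hlaced : b.cartanMatrix.IsSimplyLaced)
    (hrank : 3 ≤ Module.finrank ℂ H)
    (ω : H.root) (hω : IsHighestRoot b ω)
    (e : L) (he : e ∈ LieAlgebra.rootSpace H ω.1) (he0 : e ≠ 0) :
    formalCharacter H (squareSubrep e) =
      AddMonoidAlgebra.single 0 (numRootPairs H 0 : ℤ)
      + ∑ lam ∈ (weightSet_finite H (-1)).toFinset,
          AddMonoidAlgebra.single lam ((numRootPairs H lam : ℤ) + 1)
      + ∑ lam ∈ (weightSet_finite H 0).toFinset,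
          AddMonoidAlgebra.single lam ((numRootPairs H lam : ℤ) - 1)
      + ∑ lam ∈ ((weightSet_finite H 1).union (weightSet_finite H 2)).toFinset,
          AddMonoidAlgebra.single lam (1 : ℤ) := by
  classical
  have hl := IsLaced.of_cartanMatrix b hlaced
  have hrank' : 2 ≤ Module.finrank ℂ H := by omega
  obtain ⟨e', f, hv, rfl⟩ := exists_rootVectors ω he he0
  have hsq (α) : symMul (e' α) (e' α) ∈ squareSubrep (e' ω) :=
    hv.sq_mem hl hrank' (symMul_self_mem_squareSubrep _) α
  have hc : -(LieAlgebra.IsKilling.rootSystem H).root ω (dualElt H ω) ≠ 0 :=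
    neg_ne_zero.mpr (root_dualElt_self_ne_zero ω)
  -- With this constant, extremality of `e' ω` says exactly that the generator is killed by the
  -- contraction.
  have hV : squareSubrep (e' ω) ≤
      contractionKer L (-(LieAlgebra.IsKilling.rootSystem H).root ω (dualElt H ω)) :=
    squareSubrep_le (hv.contraction_sq hl ω)
  ext lam
  rw [coeff_formalCharacter,
    hv.finrank_weightPart_eq hl _ hsq hc (fun t ht ↦ hV ht) lam ω hrank']
  simp only [AddMonoidAlgebra.coeff_add, Finsupp.add_apply, coeff_sum_single,
    AddMonoidAlgebra.coeff_single, Finsupp.single_apply, Set.Finite.mem_toFinset, Set.mem_union,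
    eq_comm (a := (0 : weightLattice H))]
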